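/- Let $n\ge 2$, $k\in\mathbb N_0$ and $\gamma>0$. There are constants $C_1,C_2>0$ that depend only on $n$, $k$ and $\gamma$ such that the following holds. Let $\Omega\subset\mathbb R^n$ be a bounded domain with $\Omega=\operatorname{int}(\overline\Omega)$ (for instance, a polyhedral bounded Lipschitz domain), and let $\mathcal T$ be a finite conforming triangulation of $\overline\Omega$ into closed $n$-simplices that is $\gamma$-shape-regular, i.e., $h_T\le\gamma\rho_T$ for all $T\in\mathcal T$, where $h_K$ denotes the diameter of $K$ and $\rho_T$ the diameter of the largest ball contained in $T$. Let $\mathcal F$ be the set of facets of $\mathcal T$ and $\mathcal F(T)$ the set of the $n+1$ facets of $T$, let $\nu_T$ be the outer unit normal of $T$, and let $\Pi_{K,k}$ be the $L^2(K)$ projection onto the space $P_k(K)$ of polynomials of total degree at most $k$ on a simplex or facet $K$. Let $V_h$ be the space of pairs $v_h=(v_{\mathcal T},v_{\mathcal F})$ with $v_{\mathcal T}|_T\in P_k(T)$ for all $T\in\mathcal T$, $v_{\mathcal F}|_F\in P_k(F)$ for all $F\in\mathcal F$, and $v_{\mathcal F}|_F=0$ for all facets $F\subset\partial\Omega$. For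 $v_h\in V_h$ let $Rv_h$ be the unique piecewise polynomial of degree at most $k+1$ with respect to $\mathcal T$ such that $\int_T(Rv_h-v_{\mathcal T})\,dx=0$ for all $T\in\mathcal T$ and, for all piecewise polynomials $w$ of degree at most $k+1$, $$\sum_{T\in\mathcal T}\int_T\nabla Rv_h\cdot\nabla w\,dx=\sum_{T\in\mathcal T}\int_T\nabla v_{\mathcal T}\cdot\nabla w\,dx-\sum_{T\in\mathcal T}\sum_{F\in\mathcal F(T)}\int_F(v_{\mathcal T}|_T-v_{\mathcal F})\,\nabla w|_T\cdot\nu_T\,ds.$$ For $T\in\mathcal T$ and $F\in\mathcal F(T)$ set $S_{TF}v_h=\Pi_{F,k}\big((v_{\mathcal T}+(1-\Pi_{T,k})Rv_h)|_T\big)-v_{\mathcal F}|_F$ and $$\tilde s_T(v_h,v_h)=h_T^{-2}\|\Pi_{T,k}(v_{\mathcal T}-Rv_h)\|_{L^2(T)}^2+\sum_{F\in\mathcal F(T)}h_F^{-1}\|\Pi_{F,k}(v_{\mathcal F}-Rv_h|_T)\|_{L^2(F)}^2.$$ Then all $v_h\in V_h$ and $T\in\mathcal T$ satisfy $$C_1^{-1}\,\tilde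 s_T(v_h,v_h)\le\sum_{F\in\mathcal F(T)}h_F^{-1}\|S_{TF}v_h\|_{L^2(F)}^2\le C_2\,\tilde s_T(v_h,v_h).$$ -/

import Mathlib

open MeasureTheory

noncomputable section

namespace HHO

/-- The Euclidean space `ℝⁿ`. -/
abbrev Space (n : ℕ) : Type := EuclideanSpace ℝ (Fin n)

/-! ### Polynomials -/

/-- Real polynomials in `n` variables. -/
abbrev Poly (n : ℕ) : Type := MvPolynomial (Fin n) ℝ

/-- Polynomials in `n` variables of total degree at most `k`. An element of `P_k(K)`, for a
simplex or a facet `K`, is represented by such a polynomial through its values on `K`. On an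
`n`-simplex the representative is unique. Two polynomials represent the same element of `P_k(F)`
on a facet `F` if they agree on `F`, and only the values on `F` enter below. -/
abbrev P (n k : ℕ) : Submodule ℝ (Poly n) := MvPolynomial.restrictTotalDegree (Fin n) ℝ k

/-- The value of a polynomial at a point. -/
def ev {n : ℕ} (p : Poly n) (x : Space n) : ℝ := MvPolynomial.eval (fun i => x i) p

/-- The gradient of a polynomial at a point. -/
def grad {n : ℕ} (p : Poly n) (x : Space n) : Space n :=
  WithLp.toLp 2 (fun i => ev (MvPolynomial.pderiv i p) x)

/-- The gradient of a polynomial is the gradient of its polynomial function. -/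
theorem hasGradientAt_ev {n : ℕ} (p : Poly n) (x : Space n) :
    HasGradientAt (ev p) (grad p x) x := by
  induction p using MvPolynomial.induction_on with
  | C a =>
    have h1 : ev (MvPolynomial.C a : Poly n) = fun _ => a := by
      funext y; simp [ev]
    have h2 : grad (MvPolynomial.C a : Poly n) x = 0 := by
      ext i; simp [grad, ev]
    rw [h1, h2]
    exact hasGradientAt_const x a
  | add p q hp hq =>
    have h1 : ev (p + q) = fun y => ev p y + ev q y := by
      funext y; simp [ev]
    have h2 : grad (p + q) x = grad p x + grad q x := by
      ext i; simp [grad, ev]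
    rw [h1, h2, hasGradientAt_iff_hasFDerivAt, map_add]
    exact hp.hasFDerivAt.add hq.hasFDerivAt
  | mul_X p i hp =>
    have h1 : ev (p * MvPolynomial.X i) = fun y => ev p y * y i := by
      funext y; simp [ev]
    rw [h1, hasGradientAt_iff_hasFDerivAt]
    have h3 : HasFDerivAt (fun y : Space n => y i)
        (EuclideanSpace.proj i : Space n →L[ℝ] ℝ) x :=
      (EuclideanSpace.proj i : Space n →L[ℝ] ℝ).hasFDerivAt
    refine (hp.hasFDerivAt.mul h3).congr_fderiv ?_
    ext y
    simp [grad, ev, PiLp.inner_apply, MvPolynomial.pderiv_X, mul_add,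
      Finset.sum_add_distrib, Finset.mul_sum, Pi.single_apply]
    simp only [apply_ite, map_zero, mul_zero, Finset.sum_ite_eq, Finset.mem_univ, if_true]
    rw [mul_comm (y i)]
    congr 1
    exact Finset.sum_congr rfl fun j _ => by ring

/-! ### Simplices and facets, given by their vertices -/

/-- The closed simplex with the given vertices. -/
abbrev hull {n : ℕ} (K : Finset (Space n)) : Set (Space n) := convexHull ℝ (K : Set (Space n))

/-- The diameter `h_K` of a simplex or facet `K`. -/
def diam {n : ℕ} (K : Finset (Space n)) : ℝ := Metric.diam (hull K)

/-- The facets of an `n`-simplex `T` with `n + 1` vertices: the subsets of `n` vertices. -/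
def facetsOf {n : ℕ} (T : Finset (Space n)) : Finset (Finset (Space n)) := T.powersetCard n

/-- The Lebesgue measure on an `n`-simplex `T`. -/
def cellMeasure {n : ℕ} (T : Finset (Space n)) : Measure (Space n) := volume.restrict (hull T)

/-- The surface measure on a facet `F`: the `(n-1)`-dimensional Hausdorff measure, normalized to
agree with the Lebesgue measure on hyperplanes. -/
def facetMeasure {n : ℕ} (F : Finset (Space n)) : Measure (Space n) := μHE[n - 1].restrict (hull F)

/-- The unit normal of the facet `F` of `T` that points out of `T`: the normalized component
orthogonal to `F` of the vector from the centroid of `T` to the centroid of `F`. -/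
def outerNormal {n : ℕ} (T F : Finset (Space n)) : Space n :=
  let w : Space n := (vectorSpan ℝ (F : Set (Space n)))ᗮ.starProjection
    (F.centroid ℝ id -ᵥ T.centroid ℝ id)
  ‖w‖⁻¹ • w

/-! ### Triangulations -/

/-- A (conforming, finite) triangulation of `Ω ⊆ ℝⁿ` into `n`-simplices: a finite simplicial
complex that covers the closure of `Ω` and in which every face belongs to an `n`-simplex. -/
structure Triangulation {n : ℕ} (Ω : Set (Space n)) extends
    Geometry.SimplicialComplex ℝ (Space n) where
  finite_faces : faces.Finite
  pure : ∀ s ∈ faces, ∃ t ∈ faces, s ⊆ t ∧ t.card = n + 1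
  space_eq : toSimplicialComplex.space = closure Ω

variable {n : ℕ} {Ω : Set (Space n)}

/-- The set `𝒯` of `n`-simplices of the triangulation. -/
def Triangulation.cells (𝒯 : Triangulation Ω) : Finset (Finset (Space n)) :=
  𝒯.finite_faces.toFinset.filter (fun s => s.card = n + 1)

/-- The set `ℱ` of facets of the triangulation. -/
def Triangulation.facets (𝒯 : Triangulation Ω) : Finset (Finset (Space n)) :=
  𝒯.finite_faces.toFinset.filter (fun s => s.card = n)

/-- Shape regularity with parameter `γ`: every `n`-simplex `T` of the triangulation satisfies
`h_T ≤ γ ρ_T` with the diameter `ρ_T` of a largest ball contained in `T`. -/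
def Triangulation.IsShapeRegular (𝒯 : Triangulation Ω) (γ : ℝ) : Prop :=
  ∀ T ∈ 𝒯.cells, ∃ (c : Space n) (r : ℝ), 0 < r ∧ Metric.closedBall c r ⊆ hull T ∧
    diam T ≤ γ * (2 * r)

/-! ### The hybrid high-order space and its operators -/

/-- The `L²` projection `Π_{K,k} f` onto the polynomials of degree at most `k`, where `μ` is the
(Lebesgue or surface) measure on `K`: a polynomial `p` of degree at most `k` such that `f - p` is
`L²(K)`-orthogonal to `P_k(K)`. Its values on `K` are uniquely determined for `f` in `L²(K)`. -/
def l2Proj (μ : Measure (Space n)) (k : ℕ) (f : Space n → ℝ) : Poly n :=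
  open Classical in
  if h : ∃ p ∈ P n k, ∀ q ∈ P n k, ∫ x, (f x - ev p x) * ev q x ∂μ = 0 then h.choose else 0

/-- The squared `L²` norm with respect to the measure `μ`. -/
def l2NormSq (μ : Measure (Space n)) (f : Space n → ℝ) : ℝ := ∫ x, f x ^ 2 ∂μ

/-- The space `V_h = P_k(𝒯) × P_k(ℱ(Ω))`: a polynomial on each `n`-simplex and on each facet,
where the facet variable vanishes on the facets in the boundary of `Ω`. (The values of `cell` and
`facet` at other finite sets are irrelevant.) -/
structure HHOSpace (𝒯 : Triangulation Ω) (k : ℕ) where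
  cell : Finset (Space n) → Poly n
  facet : Finset (Space n) → Poly n
  cell_mem : ∀ T ∈ 𝒯.cells, cell T ∈ P n k
  facet_mem : ∀ F ∈ 𝒯.facets, facet F ∈ P n k
  facet_boundary : ∀ F ∈ 𝒯.facets, hull F ⊆ frontier Ω → ∀ x ∈ hull F, ev (facet F) x = 0

variable {𝒯 : Triangulation Ω} {k : ℕ}

/-- The piecewise polynomial `r ∈ P_{k+1}(𝒯)` is the reconstruction of `v`: on each simplex, `r`
and the cell variable of `v` have the same integral mean, and `r` solves the variational problem
`a_pw(r, w) = a_pw(v_𝒯, w) - ∑_T ⟨v_𝒯|_T - v_ℱ, ∇w|_T · ν_T⟩_{L²(∂T)}` for all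
`w ∈ P_{k+1}(𝒯)`. -/
structure IsReconstruction (v : HHOSpace 𝒯 k) (r : Finset (Space n) → Poly n) : Prop where
  mem : ∀ T ∈ 𝒯.cells, r T ∈ P n (k + 1)
  mean : ∀ T ∈ 𝒯.cells, ∫ x, (ev (r T) x - ev (v.cell T) x) ∂(cellMeasure T) = 0
  variational : ∀ w : Finset (Space n) → Poly n, (∀ T ∈ 𝒯.cells, w T ∈ P n (k + 1)) →
    ∑ T ∈ 𝒯.cells, ∫ x, inner ℝ (grad (r T) x) (grad (w T) x) ∂(cellMeasure T) =
      ∑ T ∈ 𝒯.cells, ∫ x, inner ℝ (grad (v.cell T) x) (grad (w T) x) ∂(cellMeasure T) -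
      ∑ T ∈ 𝒯.cells, ∑ F ∈ facetsOf T,
        ∫ x, (ev (v.cell T) x - ev (v.facet F) x) * inner ℝ (grad (w T) x) (outerNormal T F)
          ∂(facetMeasure F)

/-- The reconstruction `R v`, i.e. the unique piecewise polynomial of degree at most `k + 1` with
the defining properties above. -/
def reconstruction (v : HHOSpace 𝒯 k) : Finset (Space n) → Poly n :=
  open Classical in
  if h : ∃ r, IsReconstruction v r then h.choose else 0

/-- `S_{TF} v = Π_{F,k}((v_𝒯 + (1 - Π_{T,k}) R v)|_T) - v_ℱ|_F`, a polynomial of degree at most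
`k` on the facet `F` of `T`. -/
def stabS (v : HHOSpace 𝒯 k) (T F : Finset (Space n)) : Poly n :=
  l2Proj (facetMeasure F) k (fun x => ev (v.cell T) x +
    (ev (reconstruction v T) x - ev (l2Proj (cellMeasure T) k (ev (reconstruction v T))) x)) -
  v.facet F

/-- The original local stabilization `∑_{F ∈ ℱ(T)} h_F⁻¹ ‖S_{TF} v‖²_{L²(F)}`. -/
def stab (v : HHOSpace 𝒯 k) (T : Finset (Space n)) : ℝ :=
  ∑ F ∈ facetsOf T, (diam F)⁻¹ * l2NormSq (facetMeasure F) (ev (stabS v T F))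

/-- The alternative local stabilization
`h_T⁻² ‖Π_{T,k}(v_𝒯 - R v)‖²_{L²(T)} + ∑_{F ∈ ℱ(T)} h_F⁻¹ ‖Π_{F,k}(v_ℱ - R v|_T)‖²_{L²(F)}`. -/
def altStab (v : HHOSpace 𝒯 k) (T : Finset (Space n)) : ℝ :=
  (diam T ^ 2)⁻¹ * l2NormSq (cellMeasure T)
    (ev (l2Proj (cellMeasure T) k (fun x => ev (v.cell T) x - ev (reconstruction v T) x))) +
  ∑ F ∈ facetsOf T, (diam F)⁻¹ * l2NormSq (facetMeasure F)
    (ev (l2Proj (facetMeasure F) k (fun x => ev (v.facet F) x - ev (reconstruction v T) x)))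

end HHO

end

/-!
Fix a simplex `T` and write `r` for `R v` on `T`, `e = Π_{T,k} (v_𝒯 - r)` and
`d_F = Π_{F,k} (v_ℱ - r)`. Since `v_𝒯 - Π_{T,k} r = e`, the polynomial `S_{TF} v` agrees with
`e - d_F` on the facet `F` (`l2NormSq_stabS`). So `stab` is the weighted sum of the
`‖e - d_F‖²_F`, while `altStab` is made up of `‖e‖²_T` and the `‖d_F‖²_F`. The triangle inequality
and the discrete trace inequality `h_F⁻¹ ‖e‖²_F ≤ N h_T⁻² ‖e‖²_T` (`exists_facet_le_cell`) bound
`stab` by `altStab`. For the converse it remains to bound `h_T⁻² ‖e‖²_T` by `stab`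
(`exists_cell_le_facets`), and this is where the reconstruction enters: its variational problem and
Green's formula give `‖∇e‖²_T = ∑_F ⟨e - d_F, ∂_ν e⟩_F` (`IsLocalReconstruction.integral_grad_sq`).
By Young's inequality and the trace inequality, the right-hand side is absorbed up to a multiple of
`stab`, and `e` has mean value zero, so that the Poincaré inequality concludes.

The constants are uniform for the following reasons. A shape-regular simplex contains a ball
`B(c, ρ)` and is contained in `B(c, 2γρ)`. On polynomials of bounded degree, seminorms over these two
balls are comparable by finite dimension, with a constant independent of `c` and `ρ` by scaling;
this yields the inverse and Poincaré inequalities (`exists_inverse`, `exists_poincare`) without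
mapping `T` to a reference simplex. Facets enter through the identity
`∫_T div ((x - z) g) = H ∫_F g`, where `z` is the vertex opposite to `F` and `H` the height over `F`
(`divergence_cone`), which follows from Fubini's theorem on the slices of `T` parallel to `F`. It
gives the trace inequality with `g = p²`, and also Gauss's theorem on `T`
(`integral_directional`), because a constant field is a linear combination of the fields `x - z`.
-/

noncomputable section

namespace HHO

/-! ### Polynomial functions and their gradients -/

section Polynomials

variable {n : ℕ}

@[simp] theorem ev_zero (x : Space n) : ev (0 : Poly n) x = 0 := by simp [ev]
@[simp] theorem ev_add (p q : Poly n) (x : Space n) : ev (p + q) x = ev p x + ev q x := by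
  simp [ev]
@[simp] theorem ev_sub (p q : Poly n) (x : Space n) : ev (p - q) x = ev p x - ev q x := by
  simp [ev]
@[simp] theorem ev_mul (p q : Poly n) (x : Space n) : ev (p * q) x = ev p x * ev q x := by
  simp [ev]
@[simp] theorem ev_smul (a : ℝ) (p : Poly n) (x : Space n) : ev (a • p) x = a * ev p x := by
  simp [ev]
@[simp] theorem ev_C (a : ℝ) (x : Space n) : ev (MvPolynomial.C a : Poly n) x = a := by
  simp [ev]
theorem ev_sum {ι : Type*} (s : Finset ι) (p : ι → Poly n) (x : Space n) :
    ev (∑ i ∈ s, p i) x = ∑ i ∈ s, ev (p i) x := by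
  simp [ev]

theorem grad_apply (p : Poly n) (x : Space n) (i : Fin n) :
    grad p x i = ev (MvPolynomial.pderiv i p) x := rfl

theorem grad_add (p q : Poly n) (x : Space n) : grad (p + q) x = grad p x + grad q x := by
  ext i; simp [grad_apply]
theorem grad_sub (p q : Poly n) (x : Space n) : grad (p - q) x = grad p x - grad q x := by
  ext i; simp [grad_apply]
theorem grad_smul (a : ℝ) (p : Poly n) (x : Space n) : grad (a • p) x = a • grad p x := by
  ext i; simp [grad_apply]
theorem grad_C (a : ℝ) (x : Space n) : grad (MvPolynomial.C a : Poly n) x = 0 := by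
  ext i; simp [grad_apply]

theorem inner_grad (p : Poly n) (x u : Space n) :
    inner ℝ (grad p x) u = ∑ i, u i * ev (MvPolynomial.pderiv i p) x := by
  simp [PiLp.inner_apply, grad_apply]

theorem hasFDerivAt_ev (p : Poly n) (x : Space n) :
    HasFDerivAt (ev p) (innerSL ℝ (grad p x)) x :=
  (hasGradientAt_ev p x).hasFDerivAt

@[fun_prop]
theorem continuous_ev (p : Poly n) : Continuous (ev p) :=
  continuous_iff_continuousAt.2 fun x => (hasFDerivAt_ev p x).continuousAt

@[fun_prop]
theorem continuous_grad (p : Poly n) : Continuous (grad p) :=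
  (PiLp.continuous_toLp 2 _).comp (continuous_pi fun _ => continuous_ev _)

theorem pderiv_mem {k : ℕ} {p : Poly n} (hp : p ∈ P n (k + 1)) (i : Fin n) :
    MvPolynomial.pderiv i p ∈ P n k := by
  rw [p.as_sum, map_sum]
  refine Submodule.sum_mem _ fun s hs => ?_
  rw [MvPolynomial.pderiv_monomial, MvPolynomial.mem_restrictTotalDegree]
  rcases Nat.eq_zero_or_pos (s i) with h0 | h0
  · simp [h0]
  · refine (MvPolynomial.totalDegree_monomial_le _ _).trans ?_
    have h1 := (MvPolynomial.le_totalDegree hs).trans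
      ((MvPolynomial.mem_restrictTotalDegree _ _ _).1 hp)
    have h2 : s - Finsupp.single i 1 + Finsupp.single i 1 = s :=
      tsub_add_cancel_of_le (Finsupp.single_le_iff.2 h0)
    have h3 : ((s - Finsupp.single i 1).sum fun _ e => e) + 1 = s.sum fun _ e => e := by
      conv_rhs => rw [← h2]
      rw [Finsupp.sum_add_index' (by simp) (by simp), Finsupp.sum_single_index (by simp)]
    change ((s - Finsupp.single i 1).sum fun _ e => e) ≤ k
    omega

theorem P_mono {k l : ℕ} (h : k ≤ l) : P n k ≤ P n l := fun p hp => by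
  rw [MvPolynomial.mem_restrictTotalDegree] at hp ⊢
  exact hp.trans h

theorem pderiv_mem_of_mem {k : ℕ} {p : Poly n} (hp : p ∈ P n k) (i : Fin n) :
    MvPolynomial.pderiv i p ∈ P n k :=
  pderiv_mem (P_mono k.le_succ hp) i

theorem C_mem (k : ℕ) (a : ℝ) : (MvPolynomial.C a : Poly n) ∈ P n k := by
  rw [MvPolynomial.mem_restrictTotalDegree]; simp

/-- A polynomial that vanishes on a set with an interior point is zero. -/
theorem eq_zero_of_ev_eq_zero {A : Set (Space n)} (hA : (interior A).Nonempty) {p : Poly n}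
    (h : ∀ x ∈ A, ev p x = 0) : p = 0 := by
  obtain ⟨c, hc⟩ := hA
  have h1 : (WithLp.toLp 2 : (Fin n → ℝ) → Space n) ⁻¹' interior A ∈ nhds (fun i => c i) :=
    (PiLp.continuous_toLp 2 _).continuousAt.preimage_mem_nhds (isOpen_interior.mem_nhds hc)
  rw [nhds_pi, Filter.mem_pi] at h1
  obtain ⟨I, -, t, ht, hsub⟩ := h1
  refine MvPolynomial.funext_set t (fun i => infinite_of_mem_nhds _ (ht i)) fun x hx => ?_
  rw [map_zero]
  exact h (WithLp.toLp 2 x) (interior_subset (hsub fun i _ => hx i (Set.mem_univ i)))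

/-- The polynomial `x ↦ p (c + r x)`. -/
def rescale (c : Space n) (r : ℝ) (p : Poly n) : Poly n :=
  MvPolynomial.aeval (fun i => MvPolynomial.C (c i) + MvPolynomial.C r * MvPolynomial.X i) p

theorem ev_rescale (c : Space n) (r : ℝ) (p : Poly n) (x : Space n) :
    ev (rescale c r p) x = ev p (c + r • x) := by
  simp only [ev, rescale, MvPolynomial.aeval_def, MvPolynomial.algebraMap_eq,
    MvPolynomial.eval_eval₂, PiLp.add_apply, PiLp.smul_apply, smul_eq_mul]
  have : (MvPolynomial.eval fun i => x i).comp MvPolynomial.C = RingHom.id ℝ := by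
    ext a; simp
  rw [this, MvPolynomial.eval₂_id]
  simp

theorem grad_rescale (c : Space n) (r : ℝ) (p : Poly n) (x : Space n) :
    grad (rescale c r p) x = r • grad p (c + r • x) := by
  have h1 : HasFDerivAt (fun x : Space n => c + r • x)
      (r • ContinuousLinearMap.id ℝ (Space n)) x :=
    ((hasFDerivAt_id x).const_smul r).const_add c
  have h2 := (hasFDerivAt_ev p (c + r • x)).comp x h1
  have h3 : ev p ∘ (fun x : Space n => c + r • x) = ev (rescale c r p) :=
    funext fun y => (ev_rescale c r p y).symm
  rw [h3] at h2
  have h4 := h2.unique (hasFDerivAt_ev _ x)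
  refine ext_inner_right ℝ fun v => ?_
  have := congrArg (fun L => L v) h4
  simp at this
  rw [← this, real_inner_smul_left]

theorem rescale_mem {k : ℕ} {p : Poly n} (hp : p ∈ P n k) (c : Space n) (r : ℝ) :
    rescale c r p ∈ P n k := by
  rw [MvPolynomial.mem_restrictTotalDegree] at hp
  rw [rescale, MvPolynomial.aeval_def, MvPolynomial.eval₂_eq']
  refine Submodule.sum_mem _ fun s hs => ?_
  rw [MvPolynomial.mem_restrictTotalDegree]
  have h1 : ∀ i, (MvPolynomial.C (c i) + MvPolynomial.C r * MvPolynomial.X i :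
      Poly n).totalDegree ≤ 1 := fun i =>
    (MvPolynomial.totalDegree_add _ _).trans (max_le (by simp)
      ((MvPolynomial.totalDegree_mul _ _).trans (by simp)))
  refine (MvPolynomial.totalDegree_mul _ _).trans ?_
  rw [MvPolynomial.algebraMap_eq, MvPolynomial.totalDegree_C, zero_add]
  refine (MvPolynomial.totalDegree_finsetProd _ _).trans ?_
  refine le_trans (Finset.sum_le_sum fun i _ => (MvPolynomial.totalDegree_pow _ _).trans
    (Nat.mul_le_mul_left _ (h1 i))) ?_
  refine le_trans ?_ ((MvPolynomial.le_totalDegree hs).trans hp)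
  simp [Finsupp.sum_fintype]

end Polynomials

/-! ### Integration over compact sets and existence of projections -/

/-- A continuous function is integrable on a compact set of finite measure. The measure need not
be locally finite: the Hausdorff measure of a facet is the case of interest. -/
theorem integrable_restrict_of_continuous {X E : Type*} [TopologicalSpace X] [MeasurableSpace X]
    [OpensMeasurableSpace X] [T2Space X] [SecondCountableTopology X] [NormedAddCommGroup E]
    {μ : Measure X} {A : Set X} (hA : IsCompact A) (hμ : μ A ≠ ⊤) {f : X → E}
    (hf : Continuous f) : Integrable f (μ.restrict A) := by
  obtain ⟨C, hC⟩ := hA.exists_bound_of_continuousOn hf.continuousOn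
  have : IsFiniteMeasure (μ.restrict A) := ⟨by simpa using hμ.lt_top⟩
  refine Integrable.mono' (integrable_const C) ?_
    ((ae_restrict_iff' hA.measurableSet).2 (.of_forall hC))
  have h := hf.continuousOn.aestronglyMeasurable_of_isCompact hA hA.measurableSet (μ := μ)
  exact h

/-- A linear functional that vanishes on the null vectors of a symmetric bilinear form on a
finite-dimensional space is represented by the form. -/
theorem exists_eq_of_symm {V : Type*} [AddCommGroup V] [Module ℝ V] [FiniteDimensional ℝ V]
    (B : V →ₗ[ℝ] V →ₗ[ℝ] ℝ) (hB : ∀ u w, B u w = B w u) (l : V →ₗ[ℝ] ℝ)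
    (hl : ∀ u, B u u = 0 → l u = 0) : ∃ u, ∀ w, B u w = l w := by
  have h1 : l ∈ LinearMap.range (LinearMap.dualMap B) := by
    rw [LinearMap.range_dualMap_eq_dualAnnihilator_ker, Submodule.mem_dualAnnihilator]
    intro u hu
    rw [LinearMap.mem_ker] at hu
    exact hl u (by rw [hu]; rfl)
  obtain ⟨φ, hφ⟩ := h1
  obtain ⟨u, rfl⟩ := (Module.evalEquiv ℝ V).surjective φ
  refine ⟨u, fun w => ?_⟩
  rw [← hφ, hB]
  simp

variable {n k : ℕ}

theorem ae_eq_zero_of_integral_sq {μ : Measure (Space n)} {f : Space n → ℝ}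
    (hf : Integrable (fun x => f x ^ 2) μ) (h : ∫ x, f x ^ 2 ∂μ = 0) : f =ᵐ[μ] 0 := by
  filter_upwards [(integral_eq_zero_iff_of_nonneg (fun x => sq_nonneg (f x)) hf).1 h] with x hx
  exact pow_eq_zero_iff two_ne_zero |>.1 hx

/-- All moments of `μ` exist, i.e. all polynomials are integrable with respect to `μ`. -/
def HasMoments (μ : Measure (Space n)) : Prop := ∀ p : Poly n, Integrable (ev p) μ

theorem HasMoments.mul {μ : Measure (Space n)} (h : HasMoments μ) (p q : Poly n) :
    Integrable (fun x => ev p x * ev q x) μ := by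
  exact (h (p * q)).congr (.of_forall fun x => ev_mul p q x)

theorem HasMoments.sq {μ : Measure (Space n)} (h : HasMoments μ) (p : Poly n) :
    Integrable (fun x => ev p x ^ 2) μ := by
  exact (h (p * p)).congr (.of_forall fun x => by simp [pow_two])

theorem hasMoments_restrict {μ : Measure (Space n)} {A : Set (Space n)} (hA : IsCompact A)
    (hμ : μ A ≠ ⊤) : HasMoments (μ.restrict A) :=
  fun p => integrable_restrict_of_continuous hA hμ (continuous_ev p)

/-- The defining property of `l2Proj` for polynomials `g`. The projection exists although the `L²`
form may be degenerate on polynomials, as it is for the surface measure of a facet. -/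
theorem l2Proj_spec {μ : Measure (Space n)} (hμ : HasMoments μ) (g : Poly n) :
    l2Proj μ k (ev g) ∈ P n k ∧
      ∀ q ∈ P n k, ∫ x, (ev g x - ev (l2Proj μ k (ev g)) x) * ev q x ∂μ = 0 := by
  have key : ∃ p ∈ P n k, ∀ q ∈ P n k, ∫ x, (ev g x - ev p x) * ev q x ∂μ = 0 := by
    let B : Poly n →ₗ[ℝ] Poly n →ₗ[ℝ] ℝ := LinearMap.mk₂ ℝ (fun p q => ∫ x, ev p x * ev q x ∂μ)
      (fun p p' q => by
        simp only [ev_add, add_mul]; exact integral_add (hμ.mul _ _) (hμ.mul _ _))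
      (fun a p q => by simp only [ev_smul, mul_assoc, integral_const_mul, smul_eq_mul])
      (fun p q q' => by
        simp only [ev_add, mul_add]; exact integral_add (hμ.mul _ _) (hμ.mul _ _))
      (fun a p q => by
        simp only [ev_smul, mul_left_comm _ a, integral_const_mul, smul_eq_mul])
    have hB : ∀ p q, B p q = ∫ x, ev p x * ev q x ∂μ := fun p q => rfl
    obtain ⟨p, hp⟩ := exists_eq_of_symm (V := P n k) (B.domRestrict₁₂ (P n k) (P n k))
      (fun u w => by
        change ∫ x, ev u.1 x * ev w.1 x ∂μ = ∫ x, ev w.1 x * ev u.1 x ∂μ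
        simp only [mul_comm]) ((B g).domRestrict (P n k)) (fun u hu => by
        change ∫ x, ev u.1 x * ev u.1 x ∂μ = 0 at hu
        change ∫ x, ev g x * ev u.1 x ∂μ = 0
        have h0 := ae_eq_zero_of_integral_sq (hμ.sq u.1) (by simpa [sq] using hu)
        refine integral_eq_zero_of_ae ?_
        filter_upwards [h0] with x hx
        simp [hx])
    refine ⟨p, p.2, fun q hq => ?_⟩
    have h1 : ∫ x, ev p.1 x * ev q x ∂μ = ∫ x, ev g x * ev q x ∂μ := hp ⟨q, hq⟩
    simp only [sub_mul]
    rw [integral_sub (hμ.mul _ _) (hμ.mul _ _), h1, sub_self]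
  rw [l2Proj, dif_pos key]
  exact key.choose_spec

/-- A polynomial of `P_k` that is orthogonal to `P_k` vanishes almost everywhere. -/
theorem ae_eq_zero_of_orthogonal {μ : Measure (Space n)} (hμ : HasMoments μ) {p : Poly n}
    (hp : p ∈ P n k) (h : ∀ q ∈ P n k, ∫ x, ev p x * ev q x ∂μ = 0) : ev p =ᵐ[μ] 0 :=
  ae_eq_zero_of_integral_sq (hμ.sq p) (by simpa [sq] using h p hp)

/-! ### Inverse and Poincaré inequalities for polynomials -/

/-- On a finite-dimensional space, one `L²` seminorm bounds another one as soon as its null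
vectors are null vectors of the other. -/
theorem exists_integral_sq_le {V X Y E F : Type*} [AddCommGroup V] [Module ℝ V]
    [FiniteDimensional ℝ V] [MeasurableSpace X] [MeasurableSpace Y]
    [NormedAddCommGroup E] [InnerProductSpace ℝ E] [NormedAddCommGroup F] [InnerProductSpace ℝ F]
    {μ : Measure X} {ν : Measure Y} (f : V →ₗ[ℝ] X → E) (g : V →ₗ[ℝ] Y → F)
    (hf : ∀ v, MemLp (f v) 2 μ) (hg : ∀ v, MemLp (g v) 2 ν)
    (h : ∀ v, f v =ᵐ[μ] 0 → g v =ᵐ[ν] 0) :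
    ∃ C : ℝ, 0 ≤ C ∧ ∀ v, ∫ y, ‖g v y‖ ^ 2 ∂ν ≤ C * ∫ x, ‖f v x‖ ^ 2 ∂μ := by
  let f' : V →ₗ[ℝ] Lp E 2 μ :=
    { toFun := fun v => (hf v).toLp (f v)
      map_add' := fun v w => by
        rw [← MemLp.toLp_add]; exact MemLp.toLp_congr _ _ (by rw [map_add])
      map_smul' := fun a v => by
        rw [RingHom.id_apply, ← MemLp.toLp_const_smul]
        exact MemLp.toLp_congr _ _ (by rw [map_smul]) }
  let g' : V →ₗ[ℝ] Lp F 2 ν :=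
    { toFun := fun v => (hg v).toLp (g v)
      map_add' := fun v w => by
        rw [← MemLp.toLp_add]; exact MemLp.toLp_congr _ _ (by rw [map_add])
      map_smul' := fun a v => by
        rw [RingHom.id_apply, ← MemLp.toLp_const_smul]
        exact MemLp.toLp_congr _ _ (by rw [map_smul]) }
  have hf2 : ∀ v, ‖f' v‖ ^ 2 = ∫ x, ‖f v x‖ ^ 2 ∂μ := fun v => by
    rw [← real_inner_self_eq_norm_sq, L2.inner_def]
    refine integral_congr_ae ?_
    filter_upwards [(hf v).coeFn_toLp] with x hx
    change inner ℝ ((hf v).toLp (f v) x) ((hf v).toLp (f v) x) = _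
    rw [hx, real_inner_self_eq_norm_sq]
  have hg2 : ∀ v, ‖g' v‖ ^ 2 = ∫ x, ‖g v x‖ ^ 2 ∂ν := fun v => by
    rw [← real_inner_self_eq_norm_sq, L2.inner_def]
    refine integral_congr_ae ?_
    filter_upwards [(hg v).coeFn_toLp] with x hx
    change inner ℝ ((hg v).toLp (g v) x) ((hg v).toLp (g v) x) = _
    rw [hx, real_inner_self_eq_norm_sq]
  have hker : LinearMap.ker f' ≤ LinearMap.ker g' := fun v hv => by
    rw [LinearMap.mem_ker] at hv ⊢
    have h1 : f v =ᵐ[μ] 0 := by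
      have := (hf v).coeFn_toLp
      change (f' v : X → E) =ᵐ[μ] f v at this
      rw [hv] at this
      exact this.symm.trans (Lp.coeFn_zero _ _ _)
    rw [Lp.eq_zero_iff_ae_eq_zero]
    exact ((hg v).coeFn_toLp).trans (h v h1)
  -- `g'` factors through the finite-dimensional range of `f'`, where linear maps are bounded.
  obtain ⟨s, hs⟩ := f'.rangeRestrict.exists_rightInverse_of_surjective f'.range_rangeRestrict
  have hL : ∀ v, g' (s (f'.rangeRestrict v)) = g' v := fun v => by
    rw [← sub_eq_zero, ← map_sub, ← LinearMap.mem_ker]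
    refine hker ?_
    rw [LinearMap.mem_ker, map_sub, sub_eq_zero]
    exact congrArg Subtype.val (LinearMap.congr_fun hs (f'.rangeRestrict v))
  let L' := LinearMap.toContinuousLinearMap (g' ∘ₗ s)
  refine ⟨‖L'‖ ^ 2, sq_nonneg _, fun v => ?_⟩
  rw [← hf2, ← hg2, ← mul_pow]
  refine pow_le_pow_left₀ (norm_nonneg _) ?_ 2
  rw [← hL v]
  exact L'.le_opNorm (f'.rangeRestrict v)

variable {n k : ℕ}

/-- The linear map that sends a polynomial `p` to the vector field `x ↦ ∇p(x)`. -/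
def gradLinear (n : ℕ) : Poly n →ₗ[ℝ] Space n → Space n where
  toFun := grad
  map_add' p q := funext fun x => grad_add p q x
  map_smul' a p := funext fun x => grad_smul a p x

/-- The linear map that sends a polynomial to its polynomial function. -/
def evLinear (n : ℕ) : Poly n →ₗ[ℝ] Space n → ℝ where
  toFun := ev
  map_add' p q := funext fun x => ev_add p q x
  map_smul' a p := funext fun x => ev_smul a p x

theorem memLp_of_continuous {E : Type*} [NormedAddCommGroup E] {A : Set (Space n)}
    (hA : IsCompact A) {f : Space n → E} (hf : Continuous f) :
    MemLp f 2 (volume.restrict A) :=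
  (memLp_two_iff_integrable_sq_norm (integrable_restrict_of_continuous hA
    hA.measure_lt_top.ne hf).aestronglyMeasurable).2
    (integrable_restrict_of_continuous hA hA.measure_lt_top.ne (by fun_prop))

/-- A continuous function that vanishes almost everywhere on a ball vanishes on it. -/
theorem eq_zero_of_ae_eq_zero_ball {E : Type*} [NormedAddCommGroup E] {c : Space n} {r : ℝ}
    {f : Space n → E} (hf : Continuous f)
    (h : f =ᵐ[volume.restrict (Metric.ball c r)] 0) : ∀ x ∈ Metric.ball c r, f x = 0 :=
  Measure.eqOn_open_of_ae_eq h Metric.isOpen_ball hf.continuousOn continuousOn_const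

theorem ev_zero_eq_of_grad_eq_zero {p : Poly n} (h : ∀ x, grad p x = 0) (x : Space n) :
    ev p x = ev p 0 :=
  is_const_of_fderiv_eq_zero (𝕜 := ℝ) (fun y => (hasFDerivAt_ev p y).differentiableAt)
    (fun y => by rw [(hasFDerivAt_ev p y).fderiv, h y, map_zero]) x 0

theorem exists_inverse_unit (n k : ℕ) (R : ℝ) : ∃ C : ℝ, 0 ≤ C ∧ ∀ p ∈ P n k,
    ∫ x in Metric.closedBall (0 : Space n) R, ‖grad p x‖ ^ 2 ≤
      C * ∫ x in Metric.closedBall (0 : Space n) 1, ev p x ^ 2 := by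
  have hc := fun r : ℝ => isCompact_closedBall (0 : Space n) r
  obtain ⟨C, hC0, hC⟩ := exists_integral_sq_le (V := P n k)
    (μ := volume.restrict (Metric.closedBall (0 : Space n) 1))
    (ν := volume.restrict (Metric.closedBall (0 : Space n) R))
    (evLinear n ∘ₗ (P n k).subtype) (gradLinear n ∘ₗ (P n k).subtype)
    (fun p => memLp_of_continuous (hc 1) (continuous_ev p.1))
    (fun p => memLp_of_continuous (hc R) (continuous_grad p.1))
    (fun p hp => by
      have h1 : ∀ x ∈ Metric.ball (0 : Space n) 1, ev p.1 x = 0 :=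
        eq_zero_of_ae_eq_zero_ball (continuous_ev p.1)
          (ae_restrict_of_ae_restrict_of_subset Metric.ball_subset_closedBall hp)
      have h2 : p.1 = 0 := eq_zero_of_ev_eq_zero
        (by rw [Metric.isOpen_ball.interior_eq]; exact Metric.nonempty_ball.2 one_pos) h1
      exact .of_forall fun x => by simp [h2])
  refine ⟨C, hC0, fun p hp => ?_⟩
  simpa [evLinear, gradLinear] using hC ⟨p, hp⟩

theorem exists_poincare_unit (n k : ℕ) (R : ℝ) : ∃ C : ℝ, 0 ≤ C ∧ ∀ p ∈ P n k,
    ∫ x in Metric.closedBall (0 : Space n) R, (ev p x - ev p 0) ^ 2 ≤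
      C * ∫ x in Metric.closedBall (0 : Space n) 1, ‖grad p x‖ ^ 2 := by
  have hc := fun r : ℝ => isCompact_closedBall (0 : Space n) r
  let g : Poly n →ₗ[ℝ] Space n → ℝ :=
    { toFun := fun p x => ev p x - ev p 0
      map_add' := fun p q => funext fun x => by simp; ring
      map_smul' := fun a p => funext fun x => by simp; ring }
  obtain ⟨C, hC0, hC⟩ := exists_integral_sq_le (V := P n k)
    (μ := volume.restrict (Metric.closedBall (0 : Space n) 1))
    (ν := volume.restrict (Metric.closedBall (0 : Space n) R))
    (gradLinear n ∘ₗ (P n k).subtype) (g ∘ₗ (P n k).subtype)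
    (fun p => memLp_of_continuous (hc 1) (continuous_grad p.1))
    (fun p => memLp_of_continuous (hc R) ((continuous_ev p.1).sub continuous_const))
    (fun p hp => by
      have h1 : ∀ x ∈ Metric.ball (0 : Space n) 1, grad p.1 x = 0 :=
        eq_zero_of_ae_eq_zero_ball (continuous_grad p.1)
          (ae_restrict_of_ae_restrict_of_subset Metric.ball_subset_closedBall hp)
      have h2 : ∀ i, MvPolynomial.pderiv i p.1 = 0 := fun i => eq_zero_of_ev_eq_zero
        (A := Metric.ball 0 1)
        (by rw [Metric.isOpen_ball.interior_eq]; exact Metric.nonempty_ball.2 one_pos)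
        fun x hx => by rw [← grad_apply, h1 x hx, PiLp.zero_apply]
      have h3 : ∀ x, grad p.1 x = 0 := fun x => by
        ext i; simp [grad_apply, h2]
      exact .of_forall fun x => sub_eq_zero.2 (ev_zero_eq_of_grad_eq_zero h3 x))
  refine ⟨C, hC0, fun p hp => ?_⟩
  simpa [g, gradLinear] using hC ⟨p, hp⟩

open scoped Pointwise in
theorem setIntegral_closedBall_eq (f : Space n → ℝ) (c : Space n) {r : ℝ} (hr : 0 < r) (R : ℝ) :
    ∫ x in Metric.closedBall c (r * R), f x =
      r ^ n * ∫ x in Metric.closedBall (0 : Space n) R, f (c + r • x) := by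
  have h1 := Measure.setIntegral_comp_smul_of_pos (volume : Measure (Space n))
    (fun x => f (c + x)) (Metric.closedBall 0 R) hr
  have h2 : r • Metric.closedBall (0 : Space n) R = Metric.closedBall 0 (r * R) := by
    rw [smul_closedBall' hr.ne', smul_zero, Real.norm_of_nonneg hr.le]
  have h3 : (fun x => c + x) ⁻¹' Metric.closedBall c (r * R) = Metric.closedBall 0 (r * R) := by
    ext x; simp [dist_eq_norm]
  have h4 := (measurePreserving_add_left (volume : Measure (Space n)) c).setIntegral_preimage_emb
    (measurableEmbedding_addLeft c) f (Metric.closedBall c (r * R))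
  rw [h1, h2, ← h4, h3, finrank_euclideanSpace_fin, smul_eq_mul,
    mul_inv_cancel_left₀ (by positivity)]

/-- Inverse inequality on a compact set of bounded chunkiness, sandwiched between two concentric
balls. -/
theorem exists_inverse (n k : ℕ) (R : ℝ) : ∃ C : ℝ, 0 ≤ C ∧
    ∀ (A : Set (Space n)) (c : Space n) (r : ℝ), 0 < r → IsCompact A →
      Metric.closedBall c r ⊆ A → A ⊆ Metric.closedBall c (r * R) → ∀ p ∈ P n k,
      r ^ 2 * ∫ x in A, ‖grad p x‖ ^ 2 ≤ C * ∫ x in A, ev p x ^ 2 := by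
  obtain ⟨C, hC0, hC⟩ := exists_inverse_unit n k R
  refine ⟨C, hC0, fun A c r hr hA h1 h2 p hp => ?_⟩
  have hi : ∀ {K : Set (Space n)}, IsCompact K → ∀ {f : Space n → ℝ}, Continuous f →
      IntegrableOn f K := fun hK f hf =>
    integrable_restrict_of_continuous hK hK.measure_lt_top.ne hf
  have h3 := setIntegral_closedBall_eq (fun x => ‖grad p x‖ ^ 2) c hr R
  have h4 := setIntegral_closedBall_eq (fun x => ev p x ^ 2) c hr 1
  have h5 := hC _ (rescale_mem hp c r)
  simp only [grad_rescale, ev_rescale, norm_smul, mul_pow, integral_const_mul, Real.norm_eq_abs,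
    sq_abs] at h5
  rw [mul_one] at h4
  have h6 : ∫ x in A, ‖grad p x‖ ^ 2 ≤ ∫ x in Metric.closedBall c (r * R), ‖grad p x‖ ^ 2 :=
    setIntegral_mono_set (hi (isCompact_closedBall _ _) (by fun_prop))
      (.of_forall fun x => sq_nonneg _) (Filter.Eventually.of_forall h2)
  have h7 : ∫ x in Metric.closedBall c r, ev p x ^ 2 ≤ ∫ x in A, ev p x ^ 2 :=
    setIntegral_mono_set (hi hA (by fun_prop))
      (.of_forall fun x => sq_nonneg _) (Filter.Eventually.of_forall h1)
  calc r ^ 2 * ∫ x in A, ‖grad p x‖ ^ 2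
      ≤ r ^ 2 * ∫ x in Metric.closedBall c (r * R), ‖grad p x‖ ^ 2 := by gcongr
    _ = r ^ n * (r ^ 2 * ∫ x in Metric.closedBall (0 : Space n) R, ‖grad p (c + r • x)‖ ^ 2) := by
      rw [h3]; ring
    _ ≤ r ^ n * (C * ∫ x in Metric.closedBall (0 : Space n) 1, ev p (c + r • x) ^ 2) := by gcongr
    _ = C * ∫ x in Metric.closedBall c r, ev p x ^ 2 := by rw [h4]; ring
    _ ≤ C * ∫ x in A, ev p x ^ 2 := by gcongr

/-- Poincaré inequality for polynomials of mean zero on a compact set of bounded chunkiness. -/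
theorem exists_poincare (n k : ℕ) (R : ℝ) : ∃ C : ℝ, 0 ≤ C ∧
    ∀ (A : Set (Space n)) (c : Space n) (r : ℝ), 0 < r → IsCompact A →
      Metric.closedBall c r ⊆ A → A ⊆ Metric.closedBall c (r * R) → ∀ p ∈ P n k,
      ∫ x in A, ev p x = 0 →
      ∫ x in A, ev p x ^ 2 ≤ C * r ^ 2 * ∫ x in A, ‖grad p x‖ ^ 2 := by
  obtain ⟨C, hC0, hC⟩ := exists_poincare_unit n k R
  refine ⟨C, hC0, fun A c r hr hA h1 h2 p hp hmean => ?_⟩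
  have hi : ∀ {K : Set (Space n)}, IsCompact K → ∀ {f : Space n → ℝ}, Continuous f →
      IntegrableOn f K := fun hK f hf =>
    integrable_restrict_of_continuous hK hK.measure_lt_top.ne hf
  have h3 := setIntegral_closedBall_eq (fun x => (ev p x - ev p c) ^ 2) c hr R
  have h4 := setIntegral_closedBall_eq (fun x => ‖grad p x‖ ^ 2) c hr 1
  have h5 := hC _ (rescale_mem hp c r)
  simp only [grad_rescale, ev_rescale, norm_smul, mul_pow, integral_const_mul, Real.norm_eq_abs,
    sq_abs, smul_zero, add_zero] at h5
  rw [mul_one] at h4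
  have h6 : ∫ x in A, (ev p x - ev p c) ^ 2 ≤
      ∫ x in Metric.closedBall c (r * R), (ev p x - ev p c) ^ 2 :=
    setIntegral_mono_set (hi (isCompact_closedBall _ _) (by fun_prop))
      (.of_forall fun x => sq_nonneg _) (Filter.Eventually.of_forall h2)
  have h7 : ∫ x in Metric.closedBall c r, ‖grad p x‖ ^ 2 ≤ ∫ x in A, ‖grad p x‖ ^ 2 :=
    setIntegral_mono_set (hi hA (by fun_prop))
      (.of_forall fun x => sq_nonneg _) (Filter.Eventually.of_forall h1)
  -- The mean value zero is the best constant approximation, in particular better than `p c`.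
  have h8 : ∫ x in A, ev p x ^ 2 ≤ ∫ x in A, (ev p x - ev p c) ^ 2 := by
    have h9 : ∀ x, (ev p x - ev p c) ^ 2 = (ev p x ^ 2 + ev p c ^ 2) - 2 * ev p c * ev p x :=
      fun x => by ring
    simp only [h9]
    rw [integral_sub (hi hA (by fun_prop)) (hi hA (by fun_prop)), integral_const_mul, hmean,
      mul_zero, sub_zero]
    exact setIntegral_mono_on (hi hA (by fun_prop)) (hi hA (by fun_prop)) hA.measurableSet
      fun x _ => le_add_of_nonneg_right (sq_nonneg _)
  calc ∫ x in A, ev p x ^ 2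
      ≤ ∫ x in Metric.closedBall c (r * R), (ev p x - ev p c) ^ 2 := h8.trans h6
    _ = r ^ n * ∫ x in Metric.closedBall (0 : Space n) R, (ev p (c + r • x) - ev p c) ^ 2 := h3
    _ ≤ r ^ n * (C * (r ^ 2 *
        ∫ x in Metric.closedBall (0 : Space n) 1, ‖grad p (c + r • x)‖ ^ 2)) := by gcongr
    _ = C * r ^ 2 * ∫ x in Metric.closedBall c r, ‖grad p x‖ ^ 2 := by rw [h4]; ring
    _ ≤ C * r ^ 2 * ∫ x in A, ‖grad p x‖ ^ 2 := by gcongr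

/-! ### The divergence theorem on a cone -/

section Cone

variable {n : ℕ} {z ν : Space n} {H : ℝ} {F : Set (Space n)}

theorem isCompact_cone (z : Space n) (hF : IsCompact F) :
    IsCompact ((fun q : ℝ × Space n => z + q.1 • (q.2 - z)) '' (Set.Icc 0 1 ×ˢ F)) :=
  (isCompact_Icc.prod hF).image (by fun_prop)

/-- Orthogonal coordinates `(t, y) ↦ z + t ν + y` with `y ⊥ ν` for a unit vector `ν`. -/
def coneCoord (z : Space n) (hν : ‖ν‖ = 1) : ℝ × (ℝ ∙ ν)ᗮ ≃ᵐ Space n :=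
  ((LinearIsometryEquiv.toSpanUnitSingleton ν hν).toHomeomorph.toMeasurableEquiv.prodCongr
    (MeasurableEquiv.refl (ℝ ∙ ν)ᗮ)).trans ((ℝ ∙ ν).measurableEquivProd z).symm

theorem coneCoord_apply (z : Space n) (hν : ‖ν‖ = 1) (q : ℝ × (ℝ ∙ ν)ᗮ) :
    coneCoord z hν q = z + (q.1 • ν + (q.2 : Space n)) := by
  change ((ℝ ∙ ν).measurableEquivProd z).symm
    (LinearIsometryEquiv.toSpanUnitSingleton ν hν q.1, q.2) = _
  rw [Submodule.measurableEquivProd_symm_apply]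
  simp [add_comm]

theorem measurePreserving_coneCoord (z : Space n) (hν : ‖ν‖ = 1) :
    MeasurePreserving (coneCoord z hν) (volume.prod volume) volume := by
  have h1 := ((ℝ ∙ ν).measurePreserving_measurableEquivProd z).symm
  rw [InnerProductSpace.euclideanHausdorffMeasure_eq_volume] at h1
  have h2 := (LinearIsometryEquiv.toSpanUnitSingleton ν hν).measurePreserving
  exact (h2.prod (MeasurePreserving.id (volume : Measure (ℝ ∙ ν)ᗮ))).trans h1

theorem finrank_orthogonal_unit (hν : ‖ν‖ = 1) : Module.finrank ℝ (ℝ ∙ ν)ᗮ = n - 1 := by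
  have h1 := (ℝ ∙ ν).finrank_add_finrank_orthogonal
  rw [finrank_span_singleton (norm_ne_zero_iff.1 (by rw [hν]; exact one_ne_zero)),
    finrank_euclideanSpace_fin] at h1
  omega

/-- The base `F` of the cone in the coordinates of its hyperplane. -/
def coneBase (z ν : Space n) (H : ℝ) (F : Set (Space n)) : Set (ℝ ∙ ν)ᗮ :=
  (fun y : (ℝ ∙ ν)ᗮ => z + (H • ν + (y : Space n))) ⁻¹' F

theorem isometry_coneBase (z ν : Space n) (H : ℝ) :
    Isometry (fun y : (ℝ ∙ ν)ᗮ => z + (H • ν + (y : Space n))) :=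
  Isometry.of_dist_eq fun x y => by simp [Subtype.dist_eq]

theorem isCompact_coneBase (hF : IsCompact F) : IsCompact (coneBase z ν H F) :=
  (isometry_coneBase z ν H).isClosedEmbedding.isCompact_preimage hF

theorem mem_range_coneBase (hν : ‖ν‖ = 1) {x : Space n} (hx : inner ℝ ν (x - z) = H) :
    x ∈ Set.range (fun y : (ℝ ∙ ν)ᗮ => z + (H • ν + (y : Space n))) := by
  refine ⟨⟨x - z - H • ν, ?_⟩, by simp⟩
  rw [Submodule.mem_orthogonal_singleton_iff_inner_right, inner_sub_right, hx, inner_smul_right,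
    real_inner_self_eq_norm_sq, hν]
  simp

theorem measure_facet_eq (hν : ‖ν‖ = 1) (hFH : ∀ y ∈ F, inner ℝ ν (y - z) = H) :
    μHE[n - 1] F = volume (coneBase z ν H F) := by
  have h1 := (isometry_coneBase z ν H).euclideanHausdorffMeasure_preimage (d := n - 1) F
  rw [← finrank_orthogonal_unit hν, InnerProductSpace.euclideanHausdorffMeasure_eq_volume,
    Set.inter_eq_left.2 fun x hx => mem_range_coneBase hν (hFH x hx)] at h1
  rw [← finrank_orthogonal_unit hν, ← h1]
  rfl

theorem setIntegral_facet_eq (hν : ‖ν‖ = 1) (hF : IsCompact F)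
    (hFH : ∀ y ∈ F, inner ℝ ν (y - z) = H) (g : Space n → ℝ) :
    ∫ x in F, g x ∂μHE[n - 1] =
      ∫ y in coneBase z ν H F, g (z + (H • ν + (y : Space n))) := by
  have h1 := (isometry_coneBase z ν H).map_euclideanHausdorffMeasure (d := n - 1)
  have h2 := (isometry_coneBase z ν H).isClosedEmbedding.measurableEmbedding.setIntegral_map
    (μ := volume) g F
  rw [← InnerProductSpace.euclideanHausdorffMeasure_eq_volume, finrank_orthogonal_unit hν, h1,
    Measure.restrict_restrict hF.measurableSet,
    Set.inter_eq_left.2 fun x hx => mem_range_coneBase hν (hFH x hx)] at h2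
  rw [h2, ← finrank_orthogonal_unit hν, InnerProductSpace.euclideanHausdorffMeasure_eq_volume]
  rfl

open scoped Pointwise in
/-- The slices of a cone parallel to its base are scaled copies of the base. -/
theorem coneCoord_mem_cone_iff (hν : ‖ν‖ = 1) (hH : 0 < H)
    (hFH : ∀ y ∈ F, inner ℝ ν (y - z) = H) {t : ℝ} (ht : t ≠ 0) (y : (ℝ ∙ ν)ᗮ) :
    coneCoord z hν (t, y) ∈
        (fun q : ℝ × Space n => z + q.1 • (q.2 - z)) '' (Set.Icc 0 1 ×ˢ F) ↔
      t ∈ Set.Ioc 0 H ∧ y ∈ (t / H) • coneBase z ν H F := by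
  rw [coneCoord_apply]
  have hy : inner ℝ ν (y : Space n) = 0 :=
    (Submodule.mem_orthogonal_singleton_iff_inner_right.1 y.2)
  constructor
  · rintro ⟨⟨s, x⟩, ⟨hs, hx⟩, h⟩
    have h : z + s • (x - z) = z + (t • ν + (y : Space n)) := h
    rw [add_right_inj] at h
    have h1 : s * H = t := by
      have := congrArg (inner ℝ ν) h
      simp only [inner_smul_right, inner_add_right, hFH x hx, hy, real_inner_self_eq_norm_sq, hν]
        at this
      linarith
    obtain ⟨w, hw⟩ := mem_range_coneBase hν (hFH x hx)
    have hs0 : 0 < s := lt_of_le_of_ne hs.1 fun h0 => ht (by rw [← h1, ← h0, zero_mul])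
    refine ⟨⟨h1 ▸ mul_pos hs0 hH, h1 ▸ mul_le_of_le_one_left hH.le hs.2⟩, w, ?_, ?_⟩
    · change z + (H • ν + (w : Space n)) ∈ F
      rw [show z + (H • ν + (w : Space n)) = x from hw]
      exact hx
    · change (t / H) • w = y
      rw [← h1, mul_div_cancel_right₀ _ hH.ne']
      ext1
      have h2 : x - z = H • ν + (w : Space n) := by rw [← hw]; simp
      rw [h2, smul_add, smul_smul, h1, add_right_inj] at h
      exact h
  · rintro ⟨ht, w, hw, rfl⟩
    refine ⟨(t / H, z + (H • ν + (w : Space n))),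
      ⟨⟨div_nonneg ht.1.le hH.le, (div_le_one hH).2 ht.2⟩, hw⟩, ?_⟩
    simp [smul_smul, div_mul_cancel₀ _ hH.ne']

open scoped Pointwise in
/-- Integration over a cone, slice by slice. -/
theorem setIntegral_cone_eq (hν : ‖ν‖ = 1) (hH : 0 < H) (hF : IsCompact F)
    (hFH : ∀ y ∈ F, inner ℝ ν (y - z) = H) {f : Space n → ℝ} (hf : Continuous f) :
    ∫ x in (fun q : ℝ × Space n => z + q.1 • (q.2 - z)) '' (Set.Icc 0 1 ×ˢ F), f x =
      ∫ y in coneBase z ν H F, ∫ t in Set.Ioc 0 H,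
        (t / H) ^ (n - 1) * f (z + (t / H) • (H • ν + (y : Space n))) := by
  set T := (fun q : ℝ × Space n => z + q.1 • (q.2 - z)) '' (Set.Icc 0 1 ×ˢ F)
  set K := coneBase z ν H F
  have hTc : IsCompact T := isCompact_cone z hF
  have hKc : IsCompact K := isCompact_coneBase hF
  have hψ := measurePreserving_coneCoord z hν
  have hme := (coneCoord z hν).measurableEmbedding
  have hTm : MeasurableSet (coneCoord z hν ⁻¹' T) := (coneCoord z hν).measurable hTc.measurableSet
  have hint : Integrable ((coneCoord z hν ⁻¹' T).indicator fun q => f (coneCoord z hν q))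
      (volume.prod volume) := by
    rw [integrable_indicator_iff hTm]
    exact (hψ.integrableOn_comp_preimage hme).2
      (integrable_restrict_of_continuous hTc hTc.measure_lt_top.ne hf)
  have hswap : Integrable (Function.uncurry fun (t : ℝ) (y : (ℝ ∙ ν)ᗮ) =>
      (t / H) ^ (n - 1) * f (z + (t / H) • (H • ν + (y : Space n))))
      ((volume.restrict (Set.Ioc 0 H)).prod (volume.restrict K)) := by
    rw [Measure.prod_restrict]
    refine IntegrableOn.mono_set (t := Set.Icc 0 H ×ˢ K) ?_
      (Set.prod_mono Set.Ioc_subset_Icc_self le_rfl)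
    have hc := isCompact_Icc.prod hKc (s := Set.Icc 0 H)
    exact integrable_restrict_of_continuous hc hc.measure_lt_top.ne (by
      unfold Function.uncurry; fun_prop)
  calc ∫ x in T, f x
      = ∫ q in coneCoord z hν ⁻¹' T, f (coneCoord z hν q) ∂(volume.prod volume) :=
        (hψ.setIntegral_preimage_emb hme f T).symm
    _ = ∫ t, ∫ y, (coneCoord z hν ⁻¹' T).indicator (fun q => f (coneCoord z hν q)) (t, y) := by
        rw [← integral_indicator hTm, integral_prod _ hint]
    _ = ∫ t, (Set.Ioc 0 H).indicator (fun t => ∫ y in K,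
          (t / H) ^ (n - 1) * f (z + (t / H) • (H • ν + (y : Space n)))) t := by
        refine integral_congr_ae ?_
        filter_upwards [Measure.ae_ne volume (0 : ℝ)] with t ht
        by_cases htH : t ∈ Set.Ioc 0 H
        · have hpos : 0 < t / H := div_pos htH.1 hH
          rw [Set.indicator_of_mem htH, integral_const_mul]
          have h1 : ∀ y : (ℝ ∙ ν)ᗮ, (coneCoord z hν ⁻¹' T).indicator
              (fun q => f (coneCoord z hν q)) (t, y) =
              ((t / H) • K).indicator (fun y => f (z + (t • ν + (y : Space n)))) y := fun y => by
            by_cases hy : y ∈ (t / H) • K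
            · have h := (coneCoord_mem_cone_iff hν hH hFH ht y).2 ⟨htH, hy⟩
              rw [Set.indicator_of_mem hy, Set.indicator_of_mem (Set.mem_preimage.2 h),
                coneCoord_apply]
            · have h : (t, y) ∉ coneCoord z hν ⁻¹' T := fun h =>
                hy ((coneCoord_mem_cone_iff hν hH hFH ht y).1 h).2
              rw [Set.indicator_of_notMem hy, Set.indicator_of_notMem h]
          have h2 := Measure.setIntegral_comp_smul_of_pos (volume : Measure (ℝ ∙ ν)ᗮ)
            (fun y => f (z + (t • ν + (y : Space n)))) K hpos
          simp only [h1]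
          rw [integral_indicator (hKc.measurableSet.const_smul₀ _)]
          rw [finrank_orthogonal_unit hν, smul_eq_mul, eq_inv_mul_iff_mul_eq₀ (by positivity)] at h2
          rw [← h2]
          simp [smul_add, smul_smul, div_mul_cancel₀ _ hH.ne']
        · rw [Set.indicator_of_notMem htH]
          refine integral_eq_zero_of_ae (.of_forall fun y => ?_)
          exact Set.indicator_of_notMem
            (fun h => htH ((coneCoord_mem_cone_iff hν hH hFH ht y).1 h).1) _
    _ = ∫ t in Set.Ioc 0 H, ∫ y in K,
          (t / H) ^ (n - 1) * f (z + (t / H) • (H • ν + (y : Space n))) :=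
        integral_indicator measurableSet_Ioc
    _ = _ := integral_integral_swap hswap

/-- The divergence theorem for the field `x ↦ (x - z) g x` on the cone with apex `z` over `F`: the
field is tangential to the sides of the cone, and its normal component on the base is `H g`. -/
theorem divergence_cone (hn : n ≠ 0) (hν : ‖ν‖ = 1) (hH : 0 < H) (hF : IsCompact F)
    (hFH : ∀ y ∈ F, inner ℝ ν (y - z) = H) (g : Poly n) :
    ∫ x in (fun q : ℝ × Space n => z + q.1 • (q.2 - z)) '' (Set.Icc 0 1 ×ˢ F),
        (n * ev g x + inner ℝ (grad g x) (x - z)) =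
      H * ∫ x in F, ev g x ∂μHE[n - 1] := by
  rw [setIntegral_cone_eq hν hH hF hFH (by fun_prop), setIntegral_facet_eq hν hF hFH,
    ← integral_const_mul]
  refine integral_congr_ae (.of_forall fun y => ?_)
  set u : Space n := H • ν + (y : Space n) with hu
  have hderiv : ∀ t : ℝ, HasDerivAt (fun t => H * ((t / H) ^ n * ev g (z + (t / H) • u)))
      ((t / H) ^ (n - 1) * (n * ev g (z + (t / H) • u) +
        inner ℝ (grad g (z + (t / H) • u)) (z + (t / H) • u - z))) t := fun t => by
    have h1 : HasDerivAt (fun t : ℝ => t / H) (1 / H) t := (hasDerivAt_id t).div_const H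
    have h2 : HasDerivAt (fun t : ℝ => z + (t / H) • u) ((1 / H) • u) t :=
      (h1.smul_const u).const_add z
    have h3 := (hasFDerivAt_ev g (z + (t / H) • u)).comp_hasDerivAt t h2
    refine (((h1.pow n).mul h3).const_mul H).congr_deriv ?_
    simp only [innerSL_apply_apply, inner_smul_right, add_sub_cancel_left, Function.comp_apply]
    obtain ⟨m, rfl⟩ := Nat.exists_eq_succ_of_ne_zero hn
    simp only [Nat.succ_eq_add_one, Nat.add_sub_cancel, pow_succ, Pi.pow_apply]
    field_simp
  change ∫ t in Set.Ioc 0 H, _ = _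
  rw [← intervalIntegral.integral_of_le hH.le,
    intervalIntegral.integral_eq_sub_of_hasDerivAt (fun t _ => hderiv t)
      (Continuous.intervalIntegrable (by fun_prop) _ _)]
  simp [hn, div_self hH.ne', ← hu]

end Cone

/-! ### Integration by parts on simplices -/

section Simplex

variable {n : ℕ} {T : Finset (Space n)} {z : Space n}

theorem facetsOf_eq_image (hT : T.card = n + 1) : facetsOf T = T.image T.erase := by
  ext F
  rw [facetsOf, Finset.mem_powersetCard, Finset.mem_image]
  constructor
  · rintro ⟨h1, h2⟩
    obtain ⟨z, hz⟩ := Finset.card_eq_one.1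
      (show (T \ F).card = 1 by rw [Finset.card_sdiff_of_subset h1]; omega)
    refine ⟨z, (Finset.mem_sdiff.1 (hz ▸ Finset.mem_singleton_self z)).1, ?_⟩
    rw [← Finset.sdiff_singleton_eq_erase, ← hz, Finset.sdiff_sdiff_eq_self h1]
  · rintro ⟨z, hz, rfl⟩
    exact ⟨Finset.erase_subset _ _, by rw [Finset.card_erase_of_mem hz, hT]; rfl⟩

theorem sum_facetsOf (hT : T.card = n + 1) (f : Finset (Space n) → ℝ) :
    ∑ F ∈ facetsOf T, f F = ∑ z ∈ T, f (T.erase z) := by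
  rw [facetsOf_eq_image hT, Finset.sum_image (Finset.erase_injOn T)]

theorem isCompact_hull (K : Finset (Space n)) : IsCompact (hull K) :=
  K.finite_toSet.isCompact_convexHull ℝ

/-- A simplex is the cone over each of its facets. -/
theorem hull_eq_cone (hz : z ∈ T) (hF : (T.erase z).Nonempty) :
    hull T = (fun q : ℝ × Space n => z + q.1 • (q.2 - z)) ''
      (Set.Icc 0 1 ×ˢ hull (T.erase z)) := by
  have h1 : (T : Set (Space n)) = insert z ((T.erase z : Finset (Space n)) : Set (Space n)) := by
    rw [← Finset.coe_insert, Finset.insert_erase hz]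
  rw [hull, h1, convexHull_insert (by exact_mod_cast hF)]
  ext x
  simp only [mem_convexJoin, Set.mem_singleton_iff, exists_eq_left, segment_eq_image',
    Set.mem_image, Set.mem_prod, Prod.exists]
  constructor
  · rintro ⟨y, hy, s, hs, rfl⟩
    exact ⟨s, y, ⟨hs, hy⟩, rfl⟩
  · rintro ⟨s, y, ⟨hs, hy⟩, rfl⟩
    exact ⟨y, hy, s, hs, rfl⟩

theorem centroid_sub_centroid (hn : n ≠ 0) (hT : T.card = n + 1) (hz : z ∈ T) {y : Space n} :
    ((n : ℝ) + 1) • ((T.erase z).centroid ℝ id - T.centroid ℝ id) =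
      (n : ℝ)⁻¹ • ∑ x ∈ T.erase z, (x - y) + (y - z) := by
  have hF : (T.erase z).card = n := by rw [Finset.card_erase_of_mem hz, hT]; rfl
  have h1 : (T.erase z).centroid ℝ id = (n : ℝ)⁻¹ • ∑ x ∈ T.erase z, x := by
    rw [Finset.centroid_def, Finset.affineCombination_eq_linear_combination _ _ _
      (Finset.sum_centroidWeights_eq_one_of_card_ne_zero ℝ _ (by omega))]
    simp [hF, Finset.smul_sum]
  have h2 : T.centroid ℝ id = ((n : ℝ) + 1)⁻¹ • (z + ∑ x ∈ T.erase z, x) := by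
    rw [Finset.centroid_def, Finset.affineCombination_eq_linear_combination _ _ _
      (Finset.sum_centroidWeights_eq_one_of_card_ne_zero ℝ _ (by omega)),
      Finset.add_sum_erase T (fun x => x) hz]
    simp [hT, Finset.smul_sum]
  have hn' : (n : ℝ) ≠ 0 := by exact_mod_cast hn
  have hn1 : (n : ℝ) + 1 ≠ 0 := by positivity
  rw [h1, h2, Finset.sum_sub_distrib, Finset.sum_const, hF, ← Nat.cast_smul_eq_nsmul ℝ]
  match_scalars <;> field_simp <;> ring

/-- The vector `outerNormal T F` is the unit normal of the facet `F` opposite to `z`, and it points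
away from `z`; the height `H` of `T` over `F` is positive. -/
theorem outerNormal_spec (hn : n ≠ 0) (hind : AffineIndependent ℝ ((↑) : T → Space n))
    (hT : T.card = n + 1) (hz : z ∈ T) :
    ‖outerNormal T (T.erase z)‖ = 1 ∧
      ∃ H : ℝ, 0 < H ∧ ∀ y ∈ T.erase z, inner ℝ (outerNormal T (T.erase z)) (y - z) = H := by
  set F := T.erase z with hFdef
  set V := vectorSpan ℝ (F : Set (Space n)) with hV
  set w := Vᗮ.starProjection (F.centroid ℝ id -ᵥ T.centroid ℝ id) with hw
  have hout : outerNormal T F = ‖w‖⁻¹ • w := rfl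
  have hproj : ∀ y ∈ F, ((n : ℝ) + 1) • w = Vᗮ.starProjection (y - z) := fun y hy => by
    rw [hw, ← map_smul, vsub_eq_sub, centroid_sub_centroid hn hT hz (y := y), map_add, add_eq_right]
    rw [Submodule.starProjection_apply_eq_zero_iff, Submodule.orthogonal_orthogonal]
    exact V.smul_mem _ (V.sum_mem fun x hx => vsub_mem_vectorSpan ℝ hx hy)
  have hFne : F.Nonempty := by
    rw [← Finset.card_pos, hFdef, Finset.card_erase_of_mem hz, hT]; omega
  have hn1 : 0 < (n : ℝ) + 1 := by positivity
  have hw0 : w ≠ 0 := fun h0 => by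
    obtain ⟨y, hy⟩ := hFne
    have h1 := hproj y hy
    rw [h0, smul_zero, eq_comm, Submodule.starProjection_apply_eq_zero_iff,
      Submodule.orthogonal_orthogonal] at h1
    have h2 : z ∈ affineSpan ℝ (F : Set (Space n)) := by
      have h3 := AffineSubspace.vadd_mem_of_mem_direction
        (s := affineSpan ℝ (F : Set (Space n))) (v := z - y) (p := y)
        (by rw [direction_affineSpan]; simpa using V.neg_mem h1)
        (subset_affineSpan ℝ _ hy)
      simpa using h3
    have h4 := hind.notMem_affineSpan_sdiff ⟨z, hz⟩ Set.univ
    refine h4 ?_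
    convert h2 using 2
    ext x
    simp only [Set.mem_image, Set.mem_sdiff, Set.mem_univ, true_and, Set.mem_singleton_iff,
      Subtype.exists, hFdef, Finset.coe_erase, Finset.mem_coe]
    constructor
    · rintro ⟨a, ha, h, rfl⟩
      exact ⟨ha, fun h' => h (Subtype.ext h')⟩
    · rintro ⟨ha, h⟩
      exact ⟨x, ha, fun h' => h (congrArg Subtype.val h'), rfl⟩
  have hwn : 0 < ‖w‖ := norm_pos_iff.2 hw0
  refine ⟨by rw [hout, norm_smul, norm_inv, norm_norm, inv_mul_cancel₀ hwn.ne'],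
    ((n : ℝ) + 1) * ‖w‖, by positivity, fun y hy => ?_⟩
  have h1 : inner ℝ w (y - z) = ((n : ℝ) + 1) * ‖w‖ ^ 2 := by
    have h2 : Vᗮ.starProjection w = w := by
      rw [Submodule.starProjection_eq_self_iff]; exact Submodule.starProjection_apply_mem _ _
    rw [← h2, Submodule.inner_starProjection_left_eq_right, ← hproj y hy, inner_smul_right,
      h2, real_inner_self_eq_norm_sq]
  rw [hout, inner_smul_left, h1]
  simp only [conj_trivial]
  field_simp

theorem hull_height {ν : Space n} {H : ℝ} (h : ∀ y ∈ T, inner ℝ ν (y - z) = H) :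
    ∀ y ∈ hull T, inner ℝ ν (y - z) = H := fun y hy => by
  have h1 : Convex ℝ {y : Space n | inner ℝ ν (y - z) = H} := by
    have : {y : Space n | inner ℝ ν (y - z) = H} =
        {y : Space n | (innerSL ℝ ν : Space n →ₗ[ℝ] ℝ) y = H + inner ℝ ν z} := by
      ext y; simp [inner_sub_right, sub_eq_iff_eq_add]
    rw [this]
    exact convex_hyperplane (LinearMap.isLinear _) _
  exact convexHull_min (fun y hy => h y hy) h1 hy

/-- The facts about a facet of a simplex, the one opposite to `z`, that the estimates rest on: the
height, the position of the outer normal, and the divergence theorem for `x ↦ (x - z) g x`. -/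
theorem exists_height (hn : n ≠ 0) (hind : AffineIndependent ℝ ((↑) : T → Space n))
    (hT : T.card = n + 1) (hz : z ∈ T) :
    ∃ H : ℝ, 0 < H ∧ (∀ y ∈ hull (T.erase z), inner ℝ (outerNormal T (T.erase z)) (y - z) = H) ∧
      HasMoments (facetMeasure (T.erase z)) ∧
      ∀ g : Poly n, ∫ x, (n * ev g x + inner ℝ (grad g x) (x - z)) ∂(cellMeasure T) =
        H * ∫ x, ev g x ∂(facetMeasure (T.erase z)) := by
  obtain ⟨hν, H, hH, h⟩ := outerNormal_spec hn hind hT hz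
  have h' := hull_height h
  refine ⟨H, hH, h', ?_, fun g => ?_⟩
  · refine hasMoments_restrict (isCompact_hull _) ?_
    rw [measure_facet_eq hν h']
    exact (isCompact_coneBase (isCompact_hull _)).measure_lt_top.ne
  · rw [cellMeasure, facetMeasure, hull_eq_cone hz (by
      rw [← Finset.card_pos, Finset.card_erase_of_mem hz, hT]; omega)]
    exact divergence_cone hn hν hH (isCompact_hull _) h' g

theorem integrable_cell {E : Type*} [NormedAddCommGroup E] (T : Finset (Space n))
    {f : Space n → E} (hf : Continuous f) : Integrable f (cellMeasure T) :=
  integrable_restrict_of_continuous (isCompact_hull T) (isCompact_hull T).measure_lt_top.ne hf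

theorem hasMoments_cell (T : Finset (Space n)) : HasMoments (cellMeasure T) :=
  fun p => integrable_cell T (continuous_ev p)

theorem hasMoments_facet (hn : n ≠ 0) (hind : AffineIndependent ℝ ((↑) : T → Space n))
    (hT : T.card = n + 1) {F : Finset (Space n)} (hF : F ∈ facetsOf T) :
    HasMoments (facetMeasure F) := by
  rw [facetsOf_eq_image hT, Finset.mem_image] at hF
  obtain ⟨z, hz, rfl⟩ := hF
  obtain ⟨-, -, -, h, -⟩ := exists_height hn hind hT hz
  exact h

/-- Every vector is a linear combination of the vertices with coefficients of sum zero. -/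
theorem exists_weights (hind : AffineIndependent ℝ ((↑) : T → Space n)) (hT : T.card = n + 1)
    (u : Space n) : ∃ c : Space n → ℝ, ∑ z ∈ T, c z = 0 ∧ ∑ z ∈ T, c z • z = u := by
  have h1 : affineSpan ℝ (Set.range ((↑) : T → Space n)) = ⊤ := by
    rw [hind.affineSpan_eq_top_iff_card_eq_finrank_add_one]
    simp [hT]
  have h2 : u ∈ vectorSpan ℝ (Set.range ((↑) : T → Space n)) := by
    rw [← direction_affineSpan, h1, AffineSubspace.direction_top]; trivial
  obtain ⟨s, w, hw, hu⟩ := (mem_vectorSpan_iff_eq_weightedVSub ℝ).1 h2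
  classical
  have hs : T.attach ∩ s = s := Finset.inter_eq_right.2 fun x _ => Finset.mem_attach _ x
  refine ⟨fun x => if hx : x ∈ T then (if (⟨x, hx⟩ : T) ∈ s then w ⟨x, hx⟩ else 0) else 0, ?_, ?_⟩
  · rw [← Finset.sum_coe_sort]
    simpa [hs] using hw
  · rw [hu, Finset.weightedVSub_eq_linear_combination _ hw, ← Finset.sum_coe_sort]
    simp [ite_smul, hs]

/-- Gauss's theorem on a simplex, in a constant direction `u`. In terms of weights `c` with
`u = ∑ c z • z` and `∑ c z = 0`, the constant field `u` is `-∑ c z • (x - z)`, a combination of the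
fields `x - z`, each of which is tangential to all facets but the one opposite to `z`. -/
theorem integral_directional (hn : n ≠ 0) (hind : AffineIndependent ℝ ((↑) : T → Space n))
    (hT : T.card = n + 1) (g : Poly n) (u : Space n) :
    ∫ x, inner ℝ (grad g x) u ∂(cellMeasure T) =
      ∑ F ∈ facetsOf T, inner ℝ u (outerNormal T F) * ∫ x, ev g x ∂(facetMeasure F) := by
  obtain ⟨c, hc0, hcu⟩ := exists_weights hind hT u
  have key : ∀ z : Space n, z ∈ T → ∃ H : ℝ,
      (∀ y ∈ T, y ≠ z → inner ℝ (outerNormal T (T.erase z)) (y - z) = H) ∧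
      ∫ x, (n * ev g x + inner ℝ (grad g x) (x - z)) ∂(cellMeasure T) =
        H * ∫ x, ev g x ∂(facetMeasure (T.erase z)) := fun z hz => by
    obtain ⟨H, -, h1, -, h2⟩ := exists_height hn hind hT hz
    exact ⟨H, fun y hy hyz => h1 y (subset_convexHull ℝ _ (Finset.mem_erase.2 ⟨hyz, hy⟩)), h2 g⟩
  have hpt : ∀ x, inner ℝ (grad g x) u =
      ∑ z ∈ T, -c z * (n * ev g x + inner ℝ (grad g x) (x - z)) := fun x => by
    have h1 : ∑ z ∈ T, c z * inner ℝ (grad g x) z = inner ℝ (grad g x) u := by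
      rw [← hcu, inner_sum]; simp [inner_smul_right]
    have h2 : ∀ z, -c z * (n * ev g x + inner ℝ (grad g x) (x - z)) =
        -(n * ev g x + inner ℝ (grad g x) x) * c z + c z * inner ℝ (grad g x) z := fun z => by
      rw [inner_sub_right]; ring
    simp only [h2]
    rw [Finset.sum_add_distrib, ← Finset.mul_sum, hc0, h1]; ring
  simp only [hpt]
  rw [integral_finsetSum _ fun z _ => integrable_cell T (by fun_prop), sum_facetsOf hT]
  refine Finset.sum_congr rfl fun z hz => ?_
  obtain ⟨H, h1, h2⟩ := key z hz
  rw [integral_const_mul, h2, ← mul_assoc]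
  congr 1
  have h3 : inner ℝ u (outerNormal T (T.erase z)) =
      ∑ y ∈ T, c y * inner ℝ (outerNormal T (T.erase z)) (y - z) := by
    simp only [inner_sub_right, mul_sub, Finset.sum_sub_distrib, ← Finset.sum_mul, hc0, zero_mul,
      sub_zero]
    rw [← hcu, sum_inner]
    exact Finset.sum_congr rfl fun y _ => by
      rw [inner_smul_left, real_inner_comm]; rfl
  rw [h3, ← Finset.add_sum_erase _ _ hz, sub_self, inner_zero_right, mul_zero, zero_add,
    Finset.sum_congr rfl fun y hy => by
      rw [h1 y (Finset.mem_of_mem_erase hy) (Finset.ne_of_mem_erase hy)], ← Finset.sum_mul]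
  have h4 := Finset.add_sum_erase T c hz
  rw [hc0] at h4
  rw [eq_neg_of_add_eq_zero_right h4]

/-- The Laplacian of a polynomial. -/
def laplacian (w : Poly n) : Poly n := ∑ i, MvPolynomial.pderiv i (MvPolynomial.pderiv i w)

theorem laplacian_mem {k : ℕ} {w : Poly n} (hw : w ∈ P n k) : laplacian w ∈ P n k :=
  Submodule.sum_mem _ fun i _ => pderiv_mem_of_mem (pderiv_mem_of_mem hw i) i

/-- The derivative of a polynomial in the direction `u`. -/
def directional (u : Space n) (w : Poly n) : Poly n := ∑ i, u i • MvPolynomial.pderiv i w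

theorem ev_directional (u : Space n) (w : Poly n) (x : Space n) :
    ev (directional u w) x = inner ℝ (grad w x) u := by
  rw [inner_grad, directional, ev_sum]; simp

theorem directional_mem {k : ℕ} {w : Poly n} (hw : w ∈ P n (k + 1)) (u : Space n) :
    directional u w ∈ P n k :=
  Submodule.sum_mem _ fun i _ => Submodule.smul_mem _ _ (pderiv_mem hw i)

/-- Green's formula on a simplex. -/
theorem green (hn : n ≠ 0) (hind : AffineIndependent ℝ ((↑) : T → Space n))
    (hT : T.card = n + 1) (f w : Poly n) :
    ∫ x, inner ℝ (grad f x) (grad w x) ∂(cellMeasure T) +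
        ∫ x, ev f x * ev (laplacian w) x ∂(cellMeasure T) =
      ∑ F ∈ facetsOf T, ∫ x, ev f x * inner ℝ (grad w x) (outerNormal T F) ∂(facetMeasure F) := by
  have h1 : ∀ i, ∫ x, inner ℝ (grad (f * MvPolynomial.pderiv i w) x) (EuclideanSpace.single i 1)
      ∂(cellMeasure T) = ∑ F ∈ facetsOf T, ∫ x,
        ev f x * (outerNormal T F i * ev (MvPolynomial.pderiv i w) x) ∂(facetMeasure F) :=
    fun i => by
      rw [integral_directional hn hind hT]
      refine Finset.sum_congr rfl fun F hF => ?_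
      rw [← integral_const_mul]
      refine integral_congr_ae (.of_forall fun x => ?_)
      simp [EuclideanSpace.inner_single_left]
      ring
  rw [← integral_add (integrable_cell T (by fun_prop)) (integrable_cell T (by fun_prop))]
  have h2 : ∀ x, inner ℝ (grad f x) (grad w x) + ev f x * ev (laplacian w) x =
      ∑ i, inner ℝ (grad (f * MvPolynomial.pderiv i w) x) (EuclideanSpace.single i 1) :=
    fun x => by
      rw [laplacian, ev_sum, Finset.mul_sum, inner_grad, ← Finset.sum_add_distrib]
      refine Finset.sum_congr rfl fun i _ => ?_
      rw [EuclideanSpace.inner_single_right]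
      simp [grad_apply]
      ring
  simp only [h2]
  rw [integral_finsetSum _ fun i _ => integrable_cell T (by fun_prop)]
  simp only [h1]
  rw [Finset.sum_comm]
  refine Finset.sum_congr rfl fun F hF => ?_
  rw [← integral_finsetSum]
  · simp only [inner_grad, Finset.mul_sum]
  · intro i _
    refine (hasMoments_facet hn hind hT hF
      (f * (outerNormal T F i • MvPolynomial.pderiv i w))).congr (.of_forall fun x => ?_)
    simp [mul_left_comm]

end Simplex

/-! ### Shape-regular simplices and the discrete trace inequality -/

section ShapeRegular

variable {n : ℕ} {γ : ℝ} {T : Finset (Space n)} {c : Space n} {r : ℝ}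

/-- The finite set `T` consists of the vertices of an `n`-simplex that contains the ball with
center `c` and radius `r`, and whose diameter is at most `γ` times the diameter of that ball. -/
structure IsRegularSimplex (γ : ℝ) (T : Finset (Space n)) (c : Space n) (r : ℝ) : Prop where
  indep : AffineIndependent ℝ ((↑) : T → Space n)
  card_eq : T.card = n + 1
  pos : 0 < r
  ball_subset : Metric.closedBall c r ⊆ hull T
  diam_le : diam T ≤ γ * (2 * r)

theorem dist_le_diam {K : Finset (Space n)} {x y : Space n} (hx : x ∈ hull K) (hy : y ∈ hull K) :
    dist x y ≤ diam K :=
  Metric.dist_le_diam_of_mem (isCompact_hull K).isBounded hx hy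

theorem diam_mono {K L : Finset (Space n)} (h : K ⊆ L) : diam K ≤ diam L :=
  Metric.diam_mono (convexHull_mono (Finset.coe_subset.2 h)) (isCompact_hull L).isBounded

theorem IsRegularSimplex.subset_ball (h : IsRegularSimplex γ T c r) :
    hull T ⊆ Metric.closedBall c (r * (2 * γ)) := fun x hx => by
  have h1 := dist_le_diam hx (h.ball_subset (Metric.mem_closedBall_self h.pos.le))
  rw [Metric.mem_closedBall]
  linarith [h.diam_le]

theorem add_smul_mem_ball (c : Space n) (hr : 0 < r) {e : Space n} (he : ‖e‖ = 1) :
    c + r • e ∈ Metric.closedBall c r ∧ c - r • e ∈ Metric.closedBall c r := by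
  constructor <;> simp [dist_eq_norm, norm_smul, he, abs_of_pos hr]

/-- The height over a facet is at least the diameter of an inscribed ball. -/
theorem IsRegularSimplex.two_mul_le_height (h : IsRegularSimplex γ T c r) (hn : n ≠ 0)
    {z ν : Space n} (hz : z ∈ T) (hν : ‖ν‖ = 1) {H : ℝ} (hH : 0 < H)
    (hFH : ∀ y ∈ hull (T.erase z), inner ℝ ν (y - z) = H) : 2 * r ≤ H := by
  have h1 : ∀ x ∈ hull T, 0 ≤ inner ℝ ν (x - z) ∧ inner ℝ ν (x - z) ≤ H := fun x hx => by
    rw [hull_eq_cone hz (by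
      rw [← Finset.card_pos, Finset.card_erase_of_mem hz, h.card_eq]; omega)] at hx
    obtain ⟨⟨s, y⟩, ⟨hs, hy⟩, rfl⟩ := hx
    simp only [add_sub_cancel_left, inner_smul_right, hFH y hy]
    exact ⟨mul_nonneg hs.1 hH.le, mul_le_of_le_one_left hH.le hs.2⟩
  obtain ⟨hp, hm⟩ := add_smul_mem_ball c h.pos hν
  have h2 := (h1 _ (h.ball_subset hp)).2
  have h3 := (h1 _ (h.ball_subset hm)).1
  have h4 : inner ℝ ν (c + r • ν - z) - inner ℝ ν (c - r • ν - z) = 2 * r := by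
    rw [← inner_sub_right, show c + r • ν - z - (c - r • ν - z) = (2 * r) • ν by module,
      inner_smul_right, real_inner_self_eq_norm_sq, hν]
    ring
  linarith

/-- In dimension at least two, the diameter of a facet is at least the diameter of an inscribed
ball: project along an edge from the apex to the facet. -/
theorem IsRegularSimplex.two_mul_le_diam (h : IsRegularSimplex γ T c r) (hn : 2 ≤ n)
    {z : Space n} (hz : z ∈ T) : 2 * r ≤ diam (T.erase z) := by
  have hF : (T.erase z).Nonempty := by
    rw [← Finset.card_pos, Finset.card_erase_of_mem hz, h.card_eq]; omega
  obtain ⟨y₀, hy₀⟩ := hF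
  have hy₀' : y₀ ∈ hull (T.erase z) := subset_convexHull ℝ _ hy₀
  obtain ⟨e, he, hperp⟩ : ∃ e : Space n, ‖e‖ = 1 ∧ inner ℝ e (y₀ - z) = 0 := by
    have h1 := (ℝ ∙ (y₀ - z)).finrank_add_finrank_orthogonal
    have h2 := finrank_span_le_card (R := ℝ) ({y₀ - z} : Set (Space n))
    rw [Set.toFinset_singleton, Finset.card_singleton] at h2
    rw [finrank_euclideanSpace_fin] at h1
    have : Nontrivial (ℝ ∙ (y₀ - z))ᗮ := Module.nontrivial_of_finrank_pos (R := ℝ) (by omega)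
    obtain ⟨e, he⟩ := exists_norm_eq (ℝ ∙ (y₀ - z))ᗮ zero_le_one
    exact ⟨e, he, Submodule.mem_orthogonal_singleton_iff_inner_left.1 e.2⟩
  have h1 : ∀ x ∈ hull T, ∃ w ∈ hull (T.erase z), inner ℝ e (x - y₀) = inner ℝ e (w - y₀) :=
    fun x hx => by
      rw [hull_eq_cone hz ⟨y₀, hy₀⟩] at hx
      obtain ⟨⟨s, y⟩, ⟨hs, hy⟩, rfl⟩ := hx
      refine ⟨y₀ + s • (y - y₀), (convex_convexHull ℝ _).add_smul_sub_mem hy₀' hy hs, ?_⟩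
      rw [show z + s • (y - z) - y₀ = s • (y - y₀) - (1 - s) • (y₀ - z) by module,
        inner_sub_right, inner_smul_right _ _ (1 - s), hperp, add_sub_cancel_left]
      ring
  obtain ⟨hp, hm⟩ := add_smul_mem_ball c h.pos he
  obtain ⟨w₁, hw₁, h2⟩ := h1 _ (h.ball_subset hp)
  obtain ⟨w₂, hw₂, h3⟩ := h1 _ (h.ball_subset hm)
  have h4 : inner ℝ e (c + r • e - y₀) - inner ℝ e (c - r • e - y₀) = 2 * r := by
    rw [← inner_sub_right, show c + r • e - y₀ - (c - r • e - y₀) = (2 * r) • e by module,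
      inner_smul_right, real_inner_self_eq_norm_sq, he]
    ring
  have h5 : inner ℝ e (w₁ - w₂) = 2 * r := by
    rw [← h4, h2, h3, ← inner_sub_right, sub_sub_sub_cancel_right]
  calc 2 * r = inner ℝ e (w₁ - w₂) := h5.symm
    _ ≤ ‖e‖ * ‖w₁ - w₂‖ := real_inner_le_norm _ _
    _ = dist w₁ w₂ := by rw [he, one_mul, dist_eq_norm]
    _ ≤ _ := dist_le_diam hw₁ hw₂

/-- Discrete trace inequality. It follows from the divergence theorem for `x ↦ (x - z) p(x)²` and
the inverse inequality. -/
theorem exists_trace (n k : ℕ) (hn : n ≠ 0) (γ : ℝ) : ∃ C : ℝ, 0 ≤ C ∧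
    ∀ (T : Finset (Space n)) (c : Space n) (r : ℝ), IsRegularSimplex γ T c r →
      ∀ F ∈ facetsOf T, ∀ p ∈ P n k,
      r * ∫ x, ev p x ^ 2 ∂(facetMeasure F) ≤ C * ∫ x, ev p x ^ 2 ∂(cellMeasure T) := by
  obtain ⟨C, hC0, hC⟩ := exists_inverse n k (2 * γ)
  refine ⟨n + 1 + (2 * γ) ^ 2 * C, by positivity, fun T c r h F hF p hp => ?_⟩
  rw [facetsOf_eq_image h.card_eq, Finset.mem_image] at hF
  obtain ⟨z, hz, rfl⟩ := hF
  obtain ⟨H, hH, h1, -, h2⟩ := exists_height hn h.indep h.card_eq hz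
  have hHr := h.two_mul_le_height hn hz (outerNormal_spec hn h.indep h.card_eq hz).1 hH h1
  have h3 := h2 (p * p)
  have h4 : ∀ x ∈ hull T, n * ev (p * p) x + inner ℝ (grad (p * p) x) (x - z) ≤
      (n + 1) * ev p x ^ 2 + (2 * γ * r) ^ 2 * ‖grad p x‖ ^ 2 := fun x hx => by
    have h5 : grad (p * p) x = (2 * ev p x) • grad p x := by
      ext i; simp [grad_apply]; ring
    have h6 : ‖x - z‖ ≤ 2 * γ * r := by
      have := (dist_le_diam hx (subset_convexHull ℝ _ hz)).trans h.diam_le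
      rw [dist_eq_norm] at this
      linarith
    have h7 := (abs_real_inner_le_norm (grad p x) (x - z)).trans
      (mul_le_mul_of_nonneg_left h6 (norm_nonneg _))
    have h8 : inner ℝ (grad p x) (x - z) ^ 2 ≤ (‖grad p x‖ * (2 * γ * r)) ^ 2 :=
      sq_le_sq.2 (h7.trans (le_abs_self _))
    rw [h5, inner_smul_left, ev_mul]
    simp only [conj_trivial]
    nlinarith [sq_nonneg (ev p x - inner ℝ (grad p x) (x - z))]
  have h9 : H * ∫ x, ev p x ^ 2 ∂(facetMeasure (T.erase z)) ≤
      (n + 1) * ∫ x, ev p x ^ 2 ∂(cellMeasure T) +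
        (2 * γ * r) ^ 2 * ∫ x, ‖grad p x‖ ^ 2 ∂(cellMeasure T) := by
    have hsq : ∀ x, ev p x ^ 2 = ev (p * p) x := fun x => by rw [ev_mul, pow_two]
    simp only [hsq] at h4 ⊢
    rw [← h3, ← integral_const_mul, ← integral_const_mul,
      ← integral_add (integrable_cell T (by fun_prop)) (integrable_cell T (by fun_prop))]
    refine setIntegral_mono_on (integrable_cell T (by fun_prop)) (integrable_cell T (by fun_prop))
      (isCompact_hull T).measurableSet h4
  have h10 : r ^ 2 * ∫ x, ‖grad p x‖ ^ 2 ∂(cellMeasure T) ≤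
      C * ∫ x, ev p x ^ 2 ∂(cellMeasure T) :=
    hC _ c r h.pos (isCompact_hull T) h.ball_subset h.subset_ball p hp
  have h11 : 0 ≤ ∫ x, ev p x ^ 2 ∂(facetMeasure (T.erase z)) :=
    integral_nonneg fun x => sq_nonneg _
  have hr := h.pos
  calc r * ∫ x, ev p x ^ 2 ∂(facetMeasure (T.erase z))
      ≤ H * ∫ x, ev p x ^ 2 ∂(facetMeasure (T.erase z)) := by gcongr; linarith
    _ ≤ _ := h9
    _ = (n + 1) * ∫ x, ev p x ^ 2 ∂(cellMeasure T) +
        (2 * γ) ^ 2 * (r ^ 2 * ∫ x, ‖grad p x‖ ^ 2 ∂(cellMeasure T)) := by ring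
    _ ≤ (n + 1) * ∫ x, ev p x ^ 2 ∂(cellMeasure T) +
        (2 * γ) ^ 2 * (C * ∫ x, ev p x ^ 2 ∂(cellMeasure T)) := by gcongr
    _ = _ := by ring

theorem norm_grad_sq (p : Poly n) (x : Space n) :
    ‖grad p x‖ ^ 2 = ∑ i, ev (MvPolynomial.pderiv i p) x ^ 2 := by
  rw [EuclideanSpace.norm_sq_eq]
  simp [grad_apply]

/-- Discrete trace inequality for gradients. -/
theorem exists_trace_grad (n k : ℕ) (hn : n ≠ 0) (γ : ℝ) : ∃ C : ℝ, 0 ≤ C ∧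
    ∀ (T : Finset (Space n)) (c : Space n) (r : ℝ), IsRegularSimplex γ T c r →
      ∀ F ∈ facetsOf T, ∀ p ∈ P n k,
      r * ∫ x, ‖grad p x‖ ^ 2 ∂(facetMeasure F) ≤ C * ∫ x, ‖grad p x‖ ^ 2 ∂(cellMeasure T) := by
  obtain ⟨C, hC0, hC⟩ := exists_trace n k hn γ
  refine ⟨C, hC0, fun T c r h F hF p hp => ?_⟩
  simp only [norm_grad_sq]
  rw [integral_finsetSum _ fun i _ => (hasMoments_facet hn h.indep h.card_eq hF).sq _,
    integral_finsetSum _ fun i _ => (hasMoments_cell T).sq _, Finset.mul_sum, Finset.mul_sum]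
  exact Finset.sum_le_sum fun i _ => hC T c r h F hF _ (pderiv_mem_of_mem hp i)

end ShapeRegular

/-! ### Existence of the reconstruction -/

section Reconstruction

variable {n k : ℕ} {T : Finset (Space n)}

theorem interior_hull_nonempty (hind : AffineIndependent ℝ ((↑) : T → Space n))
    (hT : T.card = n + 1) : (interior (hull T)).Nonempty := by
  rw [interior_convexHull_nonempty_iff_affineSpan_eq_top]
  have h := hind.affineSpan_eq_top_iff_card_eq_finrank_add_one.2 (by simp [hT])
  simpa using h

/-- A polynomial that vanishes almost everywhere on an `n`-simplex is zero. -/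
theorem eq_zero_of_ae_eq_zero_cell (hind : AffineIndependent ℝ ((↑) : T → Space n))
    (hT : T.card = n + 1) {p : Poly n} (h : ev p =ᵐ[cellMeasure T] 0) : p = 0 := by
  refine eq_zero_of_ev_eq_zero (A := interior (hull T))
    (by rw [interior_interior]; exact interior_hull_nonempty hind hT) ?_
  exact Measure.eqOn_open_of_ae_eq (ae_restrict_of_ae_restrict_of_subset interior_subset h)
    isOpen_interior (continuous_ev p).continuousOn continuousOn_const

theorem directional_add (u : Space n) (p q : Poly n) :
    directional u (p + q) = directional u p + directional u q := by
  simp [directional, Finset.sum_add_distrib]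

theorem directional_smul (u : Space n) (a : ℝ) (p : Poly n) :
    directional u (a • p) = a • directional u p := by
  simp [directional, Finset.smul_sum, smul_comm a]

theorem exists_const_mean (hind : AffineIndependent ℝ ((↑) : T → Space n))
    (hT : T.card = n + 1) (f : Poly n) :
    ∃ m : ℝ, ∫ x, (ev f x - m) ∂(cellMeasure T) = 0 := by
  have hpos : (cellMeasure T).real Set.univ ≠ 0 := by
    rw [cellMeasure, measureReal_restrict_apply_univ, measureReal_def, ENNReal.toReal_ne_zero]
    refine ⟨fun h0 => ?_, (isCompact_hull T).measure_lt_top.ne⟩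
    exact (isOpen_interior.measure_pos volume (interior_hull_nonempty hind hT)).ne'
      (measure_mono_null interior_subset h0)
  refine ⟨((cellMeasure T).real Set.univ)⁻¹ * ∫ x, ev f x ∂(cellMeasure T), ?_⟩
  rw [integral_sub (hasMoments_cell T f) (integrable_cell T continuous_const), integral_const,
    smul_eq_mul, mul_inv_cancel_left₀ hpos, sub_self]

/-- The variational problem for the reconstruction on a single simplex with cell variable `a` and
facet variables `b`. -/
def IsLocalReconstruction (k : ℕ) (T : Finset (Space n)) (a : Poly n)
    (b : Finset (Space n) → Poly n) (r : Poly n) : Prop :=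
  ∀ w ∈ P n (k + 1), ∫ x, inner ℝ (grad r x) (grad w x) ∂(cellMeasure T) =
    ∫ x, inner ℝ (grad a x) (grad w x) ∂(cellMeasure T) -
      ∑ F ∈ facetsOf T, ∫ x, (ev a x - ev (b F) x) * inner ℝ (grad w x) (outerNormal T F)
        ∂(facetMeasure F)

/-- The local problem is solvable: its right-hand side vanishes if `∇w = 0`. -/
theorem exists_localReconstruction (hn : n ≠ 0) (hind : AffineIndependent ℝ ((↑) : T → Space n))
    (hT : T.card = n + 1) (a : Poly n) (b : Finset (Space n) → Poly n) :
    ∃ r ∈ P n (k + 1), ∫ x, (ev r x - ev a x) ∂(cellMeasure T) = 0 ∧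
      IsLocalReconstruction k T a b r := by
  let B : Poly n →ₗ[ℝ] Poly n →ₗ[ℝ] ℝ := LinearMap.mk₂ ℝ
    (fun p q => ∫ x, inner ℝ (grad p x) (grad q x) ∂(cellMeasure T))
    (fun p p' q => by
      simp only [grad_add, inner_add_left]
      exact integral_add (integrable_cell T (by fun_prop)) (integrable_cell T (by fun_prop)))
    (fun s p q => by
      simp only [grad_smul, real_inner_smul_left, integral_const_mul, smul_eq_mul])
    (fun p q q' => by
      simp only [grad_add, inner_add_right]
      exact integral_add (integrable_cell T (by fun_prop)) (integrable_cell T (by fun_prop)))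
    (fun s p q => by
      simp only [grad_smul, real_inner_smul_right, integral_const_mul, smul_eq_mul])
  have hB : ∀ p q, B p q = ∫ x, inner ℝ (grad p x) (grad q x) ∂(cellMeasure T) := fun _ _ => rfl
  let J : Poly n →ₗ[ℝ] ℝ :=
    { toFun := fun w => ∑ F ∈ facetsOf T,
        ∫ x, ev ((a - b F) * directional (outerNormal T F) w) x ∂(facetMeasure F)
      map_add' := fun p q => by
        rw [← Finset.sum_add_distrib]
        refine Finset.sum_congr rfl fun F hF => ?_
        have hm := hasMoments_facet hn hind hT hF
        rw [← integral_add (hm _) (hm _)]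
        simp only [directional_add, mul_add, ev_add]
      map_smul' := fun s p => by
        rw [RingHom.id_apply, smul_eq_mul, Finset.mul_sum]
        refine Finset.sum_congr rfl fun F hF => ?_
        rw [← integral_const_mul]
        simp only [directional_smul, mul_smul_comm, ev_smul] }
  have hJ : ∀ w, J w = ∑ F ∈ facetsOf T,
      ∫ x, (ev a x - ev (b F) x) * inner ℝ (grad w x) (outerNormal T F) ∂(facetMeasure F) :=
    fun w => by
      refine Finset.sum_congr rfl fun F _ => ?_
      simp only [ev_mul, ev_sub, ev_directional]
  obtain ⟨u, hu⟩ := exists_eq_of_symm (V := P n (k + 1))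
    (B.domRestrict₁₂ (P n (k + 1)) (P n (k + 1)))
    (fun p q => by
      change B p.1 q.1 = B q.1 p.1
      simp only [hB, real_inner_comm])
    ((B a - J).domRestrict (P n (k + 1))) (fun p hp => by
      have h0 : B p.1 p.1 = 0 := hp
      have h1 : ∀ i, MvPolynomial.pderiv i p.1 = 0 := fun i => by
        refine eq_zero_of_ae_eq_zero_cell hind hT ?_
        simp only [hB, real_inner_self_eq_norm_sq] at h0
        have h2 := (integral_eq_zero_iff_of_nonneg (fun x => sq_nonneg ‖grad p.1 x‖)
          (integrable_cell T (by fun_prop))).1 h0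
        filter_upwards [h2] with x hx
        have h3 : grad p.1 x = 0 := norm_eq_zero.1 (pow_eq_zero_iff two_ne_zero |>.1 hx)
        rw [← grad_apply, h3]; rfl
      have h2 : ∀ x, grad p.1 x = 0 := fun x => by
        ext i; simp [grad_apply, h1]
      change B a p.1 - J p.1 = 0
      rw [hB, hJ]
      simp [h2])
  obtain ⟨m, hm⟩ := exists_const_mean hind hT (u.1 - a)
  refine ⟨u.1 - MvPolynomial.C m, Submodule.sub_mem _ u.2 (C_mem _ _), ?_, fun w hw => ?_⟩
  · rw [← hm]
    exact integral_congr_ae (.of_forall fun x => by simp; ring)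
  · simp only [grad_sub, grad_C, sub_zero]
    rw [← hB, ← hB, ← hJ]
    exact hu ⟨w, hw⟩

variable {Ω : Set (Space n)} {𝒯 : Triangulation Ω}

theorem Triangulation.mem_faces_of_mem_cells (hT : T ∈ 𝒯.cells) :
    T ∈ 𝒯.faces ∧ T.card = n + 1 := by
  simpa [Triangulation.cells] using hT

theorem Triangulation.mem_facets (hn : n ≠ 0) (hT : T ∈ 𝒯.cells) {F : Finset (Space n)}
    (hF : F ∈ facetsOf T) : F ∈ 𝒯.facets := by
  obtain ⟨h1, h2⟩ := Finset.mem_powersetCard.1 hF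
  simp only [Triangulation.facets, Finset.mem_filter, Set.Finite.mem_toFinset]
  exact ⟨(𝒯.isRelLowerSet_faces (mem_faces_of_mem_cells hT).1).2 h1
    (Finset.card_pos.1 (by omega)), h2⟩

theorem isReconstruction_reconstruction (hn : n ≠ 0) (v : HHOSpace 𝒯 k) :
    IsReconstruction v (reconstruction v) := by
  have key : ∃ r, IsReconstruction v r := by
    have h1 : ∀ T : Finset (Space n), ∃ r, T ∈ 𝒯.cells → r ∈ P n (k + 1) ∧
        ∫ x, (ev r x - ev (v.cell T) x) ∂(cellMeasure T) = 0 ∧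
        IsLocalReconstruction k T (v.cell T) v.facet r := fun T => by
      by_cases hT : T ∈ 𝒯.cells
      · obtain ⟨hf, hc⟩ := Triangulation.mem_faces_of_mem_cells hT
        obtain ⟨r, hr⟩ := exists_localReconstruction (k := k) hn (𝒯.indep hf) hc (v.cell T) v.facet
        exact ⟨r, fun _ => hr⟩
      · exact ⟨0, fun h => absurd h hT⟩
    choose r hr using h1
    refine ⟨r, fun T hT => (hr T hT).1, fun T hT => (hr T hT).2.1, fun w hw => ?_⟩
    rw [← Finset.sum_sub_distrib]
    exact Finset.sum_congr rfl fun T hT => (hr T hT).2.2 _ (hw T hT)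
  rw [reconstruction, dif_pos key]
  exact key.choose_spec

/-- The global variational problem decouples: test functions may be supported on one simplex. -/
theorem IsReconstruction.isLocal {v : HHOSpace 𝒯 k} {r : Finset (Space n) → Poly n}
    (h : IsReconstruction v r) (hT : T ∈ 𝒯.cells) :
    IsLocalReconstruction k T (v.cell T) v.facet (r T) := fun w hw => by
  classical
  have h1 := h.variational (Function.update 0 T w) fun T' _ => by
    by_cases hTT : T' = T
    · subst hTT; simpa using hw
    · simp [Function.update_of_ne hTT]
  have h0 : ∀ x, grad (0 : Poly n) x = 0 := fun x => by
    ext i; simp [grad_apply]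
  rwa [Finset.sum_eq_single_of_mem T hT fun T' _ hTT => by simp [Function.update_of_ne hTT, h0],
    Finset.sum_eq_single_of_mem T hT fun T' _ hTT => by simp [Function.update_of_ne hTT, h0],
    Finset.sum_eq_single_of_mem T hT fun T' _ hTT => by simp [Function.update_of_ne hTT, h0],
    Function.update_self] at h1

end Reconstruction

/-! ### The discrepancies on cells and facets -/

section Discrepancy

variable {n k : ℕ} {T F : Finset (Space n)}

/-- If `r` solves the local problem, the `L²` projections `e` of `a - r` on the cell and `d F` of
`b F - r` on the facets satisfy `∫_T |∇e|² = ∑_F ∫_F (e - d F) ∂_ν e`. This is Green's formula for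
`r - a + e`, which is orthogonal to `Δe`. -/
theorem IsLocalReconstruction.integral_grad_sq {a r : Poly n} {b d : Finset (Space n) → Poly n}
    (hr : IsLocalReconstruction k T a b r) (hn : n ≠ 0)
    (hind : AffineIndependent ℝ ((↑) : T → Space n)) (hT : T.card = n + 1) {e : Poly n}
    (he : e ∈ P n k)
    (horth : ∀ q ∈ P n k, ∫ x, (ev (a - r) x - ev e x) * ev q x ∂(cellMeasure T) = 0)
    (hd : ∀ F ∈ facetsOf T, ∀ q ∈ P n k,
      ∫ x, (ev (b F - r) x - ev (d F) x) * ev q x ∂(facetMeasure F) = 0) :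
    ∫ x, ‖grad e x‖ ^ 2 ∂(cellMeasure T) = ∑ F ∈ facetsOf T,
      ∫ x, (ev e x - ev (d F) x) * inner ℝ (grad e x) (outerNormal T F) ∂(facetMeasure F) := by
  have he' : e ∈ P n (k + 1) := P_mono k.le_succ he
  have h1 := green hn hind hT (r - a + e) e
  have h2 : ∫ x, ev (r - a + e) x * ev (laplacian e) x ∂(cellMeasure T) = 0 := by
    rw [← neg_eq_zero, ← integral_neg, ← horth _ (laplacian_mem he)]
    exact integral_congr_ae (.of_forall fun x => by simp; ring)
  have h3 : ∫ x, inner ℝ (grad (r - a + e) x) (grad e x) ∂(cellMeasure T) =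
      ∫ x, inner ℝ (grad r x) (grad e x) ∂(cellMeasure T) -
        ∫ x, inner ℝ (grad a x) (grad e x) ∂(cellMeasure T) +
        ∫ x, ‖grad e x‖ ^ 2 ∂(cellMeasure T) := by
    rw [← integral_sub (integrable_cell T (by fun_prop)) (integrable_cell T (by fun_prop)),
      ← integral_add (integrable_cell T (by fun_prop)) (integrable_cell T (by fun_prop))]
    refine integral_congr_ae (.of_forall fun x => ?_)
    simp only [grad_add, grad_sub, inner_add_left, inner_sub_left, real_inner_self_eq_norm_sq]
  have h4 : ∀ F ∈ facetsOf T,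
      ∫ x, ev (r - a + e) x * inner ℝ (grad e x) (outerNormal T F) ∂(facetMeasure F) =
      ∫ x, (ev e x - ev (d F) x) * inner ℝ (grad e x) (outerNormal T F) ∂(facetMeasure F) -
      ∫ x, (ev a x - ev (b F) x) * inner ℝ (grad e x) (outerNormal T F) ∂(facetMeasure F) :=
    fun F hF => by
      have hm := hasMoments_facet hn hind hT hF
      have h5 := hd F hF _ (directional_mem he' (outerNormal T F))
      simp only [← ev_directional, ← ev_sub, ← ev_mul] at h5 ⊢
      rw [← sub_zero (_ - _ : ℝ), ← h5, ← integral_sub (hm _) (hm _)]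
      simp only [← ev_sub]
      rw [← integral_sub (hm _) (hm _)]
      exact integral_congr_ae (.of_forall fun x => by simp; ring)
  rw [h2, h3, hr e he', Finset.sum_congr rfl h4, Finset.sum_sub_distrib] at h1
  linarith

/-- The cell discrepancy `Π_{T,k} (a - r)` is controlled by its distances to facet polynomials. -/
theorem exists_cell_le_facets (n k : ℕ) (hn : 2 ≤ n) (γ : ℝ) : ∃ M : ℝ, 0 ≤ M ∧
    ∀ (T : Finset (Space n)) (c : Space n) (r : ℝ), IsRegularSimplex γ T c r →
      ∀ (e : Poly n) (d : Finset (Space n) → Poly n), e ∈ P n k →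
      ∫ x, ev e x ∂(cellMeasure T) = 0 →
      ∫ x, ‖grad e x‖ ^ 2 ∂(cellMeasure T) = ∑ F ∈ facetsOf T,
        ∫ x, (ev e x - ev (d F) x) * inner ℝ (grad e x) (outerNormal T F) ∂(facetMeasure F) →
      (diam T ^ 2)⁻¹ * ∫ x, ev e x ^ 2 ∂(cellMeasure T) ≤
        M * ∑ F ∈ facetsOf T, (diam F)⁻¹ * ∫ x, (ev e x - ev (d F) x) ^ 2 ∂(facetMeasure F) := by
  obtain ⟨C₂, hC₂, hpoinc⟩ := exists_poincare n k (2 * γ)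
  obtain ⟨C₃, hC₃, htr⟩ := exists_trace_grad n k (by omega) γ
  set D : ℝ := (n + 1) * C₃ + 1 with hD
  have hD0 : 0 < D := by positivity
  refine ⟨C₂ * |γ| * D, by positivity, fun T c r h e d he hmean henergy => ?_⟩
  have hr := h.pos
  have hcard : (facetsOf T).card = n + 1 := by
    rw [facetsOf_eq_image h.card_eq, Finset.card_image_of_injOn (Finset.erase_injOn T), h.card_eq]
  have hdF : ∀ F ∈ facetsOf T, 2 * r ≤ diam F ∧ diam F ≤ diam T := fun F hF => by
    refine ⟨?_, diam_mono (Finset.mem_powersetCard.1 hF).1⟩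
    rw [facetsOf_eq_image h.card_eq, Finset.mem_image] at hF
    obtain ⟨z, hz, rfl⟩ := hF
    exact h.two_mul_le_diam hn hz
  set G := ∫ x, ‖grad e x‖ ^ 2 ∂(cellMeasure T) with hG
  set S : Finset (Space n) → ℝ := fun F => ∫ x, (ev e x - ev (d F) x) ^ 2 ∂(facetMeasure F) with hS
  have hG0 : 0 ≤ G := integral_nonneg fun x => sq_nonneg _
  have hS0 : ∀ F, 0 ≤ S F := fun F => integral_nonneg fun x => sq_nonneg _
  -- Young's inequality with a weight that lets the gradient terms be absorbed.
  have hyoung : ∀ F ∈ facetsOf T,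
      2 * ∫ x, (ev e x - ev (d F) x) * inner ℝ (grad e x) (outerNormal T F) ∂(facetMeasure F) ≤
        D / r * S F + C₃ / D * G := fun F hF => by
    have hν : ‖outerNormal T F‖ = 1 := by
      rw [facetsOf_eq_image h.card_eq, Finset.mem_image] at hF
      obtain ⟨z, hz, rfl⟩ := hF
      exact (outerNormal_spec (by omega) h.indep h.card_eq hz).1
    have hm := hasMoments_facet (by omega) h.indep h.card_eq hF
    have hi1 : Integrable (fun x => (ev e x - ev (d F) x) *
        inner ℝ (grad e x) (outerNormal T F)) (facetMeasure F) := by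
      simpa only [← ev_directional, ← ev_sub] using hm.mul _ _
    have hi2 : Integrable (fun x => (ev e x - ev (d F) x) ^ 2) (facetMeasure F) := by
      simpa only [← ev_sub] using hm.sq _
    have hi3 : Integrable (fun x => ‖grad e x‖ ^ 2) (facetMeasure F) := by
      simp only [norm_grad_sq]
      exact integrable_finsetSum _ fun i _ => hm.sq _
    have h1 : ∫ x, 2 * ((ev e x - ev (d F) x) * inner ℝ (grad e x) (outerNormal T F))
          ∂(facetMeasure F) ≤
        ∫ x, (D / r * (ev e x - ev (d F) x) ^ 2 + r / D * ‖grad e x‖ ^ 2) ∂(facetMeasure F) := by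
      refine integral_mono (hi1.const_mul 2) ((hi2.const_mul _).add (hi3.const_mul _)) fun x => ?_
      have h2 : inner ℝ (grad e x) (outerNormal T F) ^ 2 ≤ ‖grad e x‖ ^ 2 := by
        have := abs_real_inner_le_norm (grad e x) (outerNormal T F)
        rw [hν, mul_one] at this
        exact sq_le_sq.2 (this.trans (le_abs_self _))
      set s := ev e x - ev (d F) x
      set t := inner ℝ (grad e x) (outerNormal T F)
      have h3 : 0 ≤ r / D := by positivity
      have h4 : D / r * s ^ 2 + r / D * t ^ 2 - 2 * (s * t) = r / D * (D / r * s - t) ^ 2 := by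
        field_simp
        ring
      have h5 := mul_le_mul_of_nonneg_left h2 h3
      have h6 := mul_nonneg h3 (sq_nonneg (D / r * s - t))
      change 2 * (s * t) ≤ D / r * s ^ 2 + r / D * ‖grad e x‖ ^ 2
      linarith
    rw [integral_const_mul, integral_add (hi2.const_mul _) (hi3.const_mul _), integral_const_mul,
      integral_const_mul] at h1
    have h7 := mul_le_mul_of_nonneg_left (htr T c r h F hF e he) (inv_nonneg.2 hD0.le)
    have h8 : r / D * ∫ x, ‖grad e x‖ ^ 2 ∂(facetMeasure F) ≤ C₃ / D * G := by
      calc _ = D⁻¹ * (r * ∫ x, ‖grad e x‖ ^ 2 ∂(facetMeasure F)) := by ring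
        _ ≤ _ := h7
        _ = _ := by ring
    linarith
  have h1 : 2 * G ≤ D / r * ∑ F ∈ facetsOf T, S F + G := by
    have h2 := Finset.sum_le_sum hyoung
    rw [← Finset.mul_sum, ← henergy, Finset.sum_add_distrib, ← Finset.mul_sum, Finset.sum_const,
      hcard, nsmul_eq_mul] at h2
    have h3 : ((n + 1 : ℕ) : ℝ) * (C₃ / D * G) ≤ G := by
      have h4 : ((n + 1 : ℕ) : ℝ) * (C₃ / D) ≤ 1 := by
        rw [mul_div_assoc', div_le_one hD0, hD]; push_cast; linarith
      calc _ = ((n + 1 : ℕ) : ℝ) * (C₃ / D) * G := by ring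
        _ ≤ 1 * G := by gcongr
        _ = G := one_mul G
    linarith
  have hdiam : diam T ≤ 2 * |γ| * r := by
    have := mul_le_mul_of_nonneg_right (le_abs_self γ) (show 0 ≤ 2 * r by positivity)
    linarith [h.diam_le]
  have h2 : ∑ F ∈ facetsOf T, S F ≤
      2 * |γ| * r * ∑ F ∈ facetsOf T, (diam F)⁻¹ * S F := by
    rw [Finset.mul_sum]
    refine Finset.sum_le_sum fun F hF => ?_
    obtain ⟨h3, h4⟩ := hdF F hF
    have h5 : 0 < diam F := by linarith
    rw [← mul_assoc]
    refine le_mul_of_one_le_left (hS0 F) ?_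
    rw [← div_eq_mul_inv, one_le_div h5]
    linarith
  have h3 : G ≤ 2 * |γ| * D * ∑ F ∈ facetsOf T, (diam F)⁻¹ * S F := by
    calc G ≤ D / r * ∑ F ∈ facetsOf T, S F := by linarith
      _ ≤ D / r * (2 * |γ| * r * ∑ F ∈ facetsOf T, (diam F)⁻¹ * S F) := by gcongr
      _ = _ := by field_simp
  have h4 : ∫ x, ev e x ^ 2 ∂(cellMeasure T) ≤ C₂ * r ^ 2 * G :=
    hpoinc _ c r hr (isCompact_hull T) h.ball_subset h.subset_ball e he hmean
  have h5 : 2 * r ≤ diam T := by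
    obtain ⟨F, hF⟩ := Finset.card_pos.1 (show 0 < (facetsOf T).card by omega)
    exact (hdF F hF).1.trans (hdF F hF).2
  have hT0 : 0 < diam T := by linarith
  have h6 : (diam T ^ 2)⁻¹ * r ^ 2 ≤ 1 / 4 := by
    rw [inv_mul_le_iff₀ (by positivity)]
    nlinarith
  calc (diam T ^ 2)⁻¹ * ∫ x, ev e x ^ 2 ∂(cellMeasure T)
      ≤ (diam T ^ 2)⁻¹ * (C₂ * r ^ 2 * G) := by gcongr
    _ = (diam T ^ 2)⁻¹ * r ^ 2 * (C₂ * G) := by ring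
    _ ≤ 1 / 4 * (C₂ * (2 * |γ| * D * ∑ F ∈ facetsOf T, (diam F)⁻¹ * S F)) := by gcongr
    _ ≤ _ := by
      have h7 : 0 ≤ C₂ * |γ| * D * ∑ F ∈ facetsOf T, (diam F)⁻¹ * S F :=
        mul_nonneg (by positivity) (Finset.sum_nonneg fun F hF =>
          mul_nonneg (inv_nonneg.2 (by linarith [(hdF F hF).1])) (hS0 F))
      linarith

/-- The discrete trace inequality in the scaling of the stabilizations. -/
theorem exists_facet_le_cell (n k : ℕ) (hn : 2 ≤ n) (γ : ℝ) : ∃ N : ℝ, 0 ≤ N ∧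
    ∀ (T : Finset (Space n)) (c : Space n) (r : ℝ), IsRegularSimplex γ T c r →
      ∀ F ∈ facetsOf T, 0 < diam F ∧ ∀ e ∈ P n k,
        (diam F)⁻¹ * ∫ x, ev e x ^ 2 ∂(facetMeasure F) ≤
          N * ((diam T ^ 2)⁻¹ * ∫ x, ev e x ^ 2 ∂(cellMeasure T)) := by
  obtain ⟨C, hC0, hC⟩ := exists_trace n k (by omega) γ
  refine ⟨2 * γ ^ 2 * C, by positivity, fun T c r h F hF => ?_⟩
  have hr := h.pos
  have h1 : 2 * r ≤ diam F := by
    rw [facetsOf_eq_image h.card_eq, Finset.mem_image] at hF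
    obtain ⟨z, hz, rfl⟩ := hF
    exact h.two_mul_le_diam hn hz
  have h2 : diam F ≤ diam T := diam_mono (Finset.mem_powersetCard.1 hF).1
  have h0 : 0 < diam F := by linarith
  refine ⟨h0, fun e he => ?_⟩
  have h3 := hC T c r h F hF e he
  have ht0 : 0 ≤ ∫ x, ev e x ^ 2 ∂(facetMeasure F) := integral_nonneg fun x => sq_nonneg _
  have ha0 : 0 ≤ ∫ x, ev e x ^ 2 ∂(cellMeasure T) := integral_nonneg fun x => sq_nonneg _
  have h4 : (r ^ 2)⁻¹ ≤ 4 * γ ^ 2 * (diam T ^ 2)⁻¹ := by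
    have h5 : diam T ^ 2 ≤ (γ * (2 * r)) ^ 2 :=
      pow_le_pow_left₀ (by linarith) h.diam_le 2
    rw [← div_eq_mul_inv, le_div_iff₀ (by nlinarith), inv_mul_le_iff₀ (by positivity)]
    linarith
  calc (diam F)⁻¹ * ∫ x, ev e x ^ 2 ∂(facetMeasure F)
      ≤ (2 * r)⁻¹ * ∫ x, ev e x ^ 2 ∂(facetMeasure F) := by gcongr
    _ = 1 / 2 * (r ^ 2)⁻¹ * (r * ∫ x, ev e x ^ 2 ∂(facetMeasure F)) := by field_simp
    _ ≤ 1 / 2 * (r ^ 2)⁻¹ * (C * ∫ x, ev e x ^ 2 ∂(cellMeasure T)) := by gcongr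
    _ ≤ 1 / 2 * (4 * γ ^ 2 * (diam T ^ 2)⁻¹) * (C * ∫ x, ev e x ^ 2 ∂(cellMeasure T)) := by
      gcongr
    _ = _ := by ring

variable {Ω : Set (Space n)} {𝒯 : Triangulation Ω}

/-- The cell discrepancy `Π_{T,k} (v_𝒯 - R v)` of the alternative stabilization. -/
def cellDisc (v : HHOSpace 𝒯 k) (T : Finset (Space n)) : Poly n :=
  l2Proj (cellMeasure T) k (fun x => ev (v.cell T) x - ev (reconstruction v T) x)

/-- The facet discrepancy `Π_{F,k} (v_ℱ - R v|_T)` of the alternative stabilization. -/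
def facetDisc (v : HHOSpace 𝒯 k) (T F : Finset (Space n)) : Poly n :=
  l2Proj (facetMeasure F) k (fun x => ev (v.facet F) x - ev (reconstruction v T) x)

theorem cellDisc_spec (v : HHOSpace 𝒯 k) (T : Finset (Space n)) :
    cellDisc v T ∈ P n k ∧ ∀ q ∈ P n k,
      ∫ x, (ev (v.cell T - reconstruction v T) x - ev (cellDisc v T) x) * ev q x
        ∂(cellMeasure T) = 0 := by
  have h : (fun x => ev (v.cell T) x - ev (reconstruction v T) x) =
      ev (v.cell T - reconstruction v T) := funext fun x => (ev_sub _ _ x).symm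
  rw [cellDisc, h]
  exact l2Proj_spec (hasMoments_cell T) _

theorem facetDisc_spec (v : HHOSpace 𝒯 k) (T : Finset (Space n))
    (hm : HasMoments (facetMeasure F)) :
    facetDisc v T F ∈ P n k ∧ ∀ q ∈ P n k,
      ∫ x, (ev (v.facet F - reconstruction v T) x - ev (facetDisc v T F) x) * ev q x
        ∂(facetMeasure F) = 0 := by
  have h : (fun x => ev (v.facet F) x - ev (reconstruction v T) x) =
      ev (v.facet F - reconstruction v T) := funext fun x => (ev_sub _ _ x).symm
  rw [facetDisc, h]
  exact l2Proj_spec hm _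

/-- On the facet `F`, the polynomial `S_{TF} v` is the difference of the cell and facet
discrepancies. -/
theorem l2NormSq_stabS (hn : n ≠ 0) (v : HHOSpace 𝒯 k) (hT : T ∈ 𝒯.cells) (hF : F ∈ facetsOf T) :
    l2NormSq (facetMeasure F) (ev (stabS v T F)) =
      ∫ x, (ev (cellDisc v T) x - ev (facetDisc v T F) x) ^ 2 ∂(facetMeasure F) := by
  obtain ⟨hf, hc⟩ := Triangulation.mem_faces_of_mem_cells hT
  have hmF := hasMoments_facet hn (𝒯.indep hf) hc hF
  have hmT := hasMoments_cell T
  set a := v.cell T with ha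
  set R := reconstruction v T with hR
  set b := v.facet F with hb
  obtain ⟨he, heo⟩ := cellDisc_spec v T
  obtain ⟨hd, hdo⟩ := facetDisc_spec v T hmF
  set e := cellDisc v T
  set d := facetDisc v T F
  obtain ⟨hp, hpo⟩ := l2Proj_spec (k := k) hmT R
  set p := l2Proj (cellMeasure T) k (ev R) with hpdef
  have hape : a - p - e = 0 := by
    refine eq_zero_of_ae_eq_zero_cell (𝒯.indep hf) hc (ae_eq_zero_of_orthogonal (k := k) hmT
      (Submodule.sub_mem _ (Submodule.sub_mem _ (v.cell_mem T hT) hp) he) fun q hq => ?_)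
    have h1 := heo q hq
    have h2 := hpo q hq
    simp only [← ev_sub] at h1 h2
    rw [← add_zero (0 : ℝ)]
    nth_rw 1 [← h1]
    rw [← h2, ← integral_add (hmT.mul _ _) (hmT.mul _ _)]
    exact integral_congr_ae (.of_forall fun x => by simp; ring)
  have hfun : (fun x => ev a x + (ev R x - ev p x)) = ev (e + R) := funext fun x => by
    rw [← sub_eq_zero.1 hape]; simp; ring
  obtain ⟨hq, hqo⟩ := l2Proj_spec (k := k) hmF (e + R)
  have hS : stabS v T F = l2Proj (facetMeasure F) k (ev (e + R)) - b := by
    rw [stabS, ← hfun]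
  have hz : ev (stabS v T F - (e - d)) =ᵐ[facetMeasure F] 0 := by
    rw [hS]
    refine ae_eq_zero_of_orthogonal (k := k) hmF (Submodule.sub_mem _ (Submodule.sub_mem _ hq
      (v.facet_mem F (Triangulation.mem_facets hn hT hF))) (Submodule.sub_mem _ he hd))
      fun w hw => ?_
    have h1 := hqo w hw
    have h2 := hdo w hw
    simp only [← ev_sub] at h1 h2
    rw [← neg_zero, ← add_zero (0 : ℝ)]
    nth_rw 1 [← h1]
    rw [← h2, ← integral_add (hmF.mul _ _) (hmF.mul _ _), ← integral_neg]
    exact integral_congr_ae (.of_forall fun x => by simp; ring)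
  refine integral_congr_ae ?_
  filter_upwards [hz] with x hx
  rw [ev_sub, ev_sub, Pi.zero_apply, sub_eq_zero] at hx
  rw [hx]

end Discrepancy

end HHO

end

theorem theorem4 (n : ℕ) (hn : 2 ≤ n) (k : ℕ) (γ : ℝ) :
    ∃ C₁ C₂ : ℝ, 0 < C₁ ∧ 0 < C₂ ∧
      ∀ (Ω : Set (HHO.Space n)), IsConnected Ω → interior (closure Ω) = Ω →
      ∀ (𝒯 : HHO.Triangulation Ω), 𝒯.IsShapeRegular γ →
      ∀ (v : HHO.HHOSpace 𝒯 k), ∀ T ∈ 𝒯.cells,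
        C₁⁻¹ * HHO.altStab v T ≤ HHO.stab v T ∧ HHO.stab v T ≤ C₂ * HHO.altStab v T := by
  obtain ⟨M, hM, hcell⟩ := HHO.exists_cell_le_facets n k hn γ
  obtain ⟨N, hN, hfacet⟩ := HHO.exists_facet_le_cell n k hn γ
  have hn0 : n ≠ 0 := by omega
  refine ⟨M + 2 + 2 * (n + 1) * N * M, 2 + 2 * (n + 1) * N, by positivity, by positivity,
    fun Ω _ _ 𝒯 hreg v T hT => ?_⟩
  obtain ⟨c, r, hr, hball, hdiam⟩ := hreg T hT
  obtain ⟨hf, hc⟩ := HHO.Triangulation.mem_faces_of_mem_cells hT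
  have hsimp : HHO.IsRegularSimplex γ T c r := ⟨𝒯.indep hf, hc, hr, hball, hdiam⟩
  have hrec := HHO.isReconstruction_reconstruction hn0 v
  obtain ⟨he, heo⟩ := HHO.cellDisc_spec v T
  have hmean : ∫ x, HHO.ev (HHO.cellDisc v T) x ∂(HHO.cellMeasure T) = 0 := by
    have h1 := heo _ (HHO.C_mem k 1)
    have h2 := hrec.mean T hT
    simp only [HHO.ev_C, mul_one] at h1
    rw [integral_sub (HHO.hasMoments_cell T _) (HHO.hasMoments_cell T _)] at h1
    simp only [HHO.ev_sub] at h1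
    rw [integral_sub (HHO.hasMoments_cell T _) (HHO.hasMoments_cell T _)] at h1 h2
    linarith
  have henergy := (hrec.isLocal hT).integral_grad_sq hn0 (𝒯.indep hf) hc he heo
    (d := HHO.facetDisc v T) fun F hF =>
      (HHO.facetDisc_spec v T (HHO.hasMoments_facet hn0 (𝒯.indep hf) hc hF)).2
  have hbulk := hcell T c r hsimp _ _ he hmean henergy
  set e := HHO.cellDisc v T with hedef
  set A : ℝ := (HHO.diam T ^ 2)⁻¹ * ∫ x, HHO.ev e x ^ 2 ∂(HHO.cellMeasure T) with hA
  set s : Finset (HHO.Space n) → ℝ := fun F => (HHO.diam F)⁻¹ *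
    ∫ x, (HHO.ev e x - HHO.ev (HHO.facetDisc v T F) x) ^ 2 ∂(HHO.facetMeasure F) with hs
  set t : Finset (HHO.Space n) → ℝ := fun F => (HHO.diam F)⁻¹ *
    ∫ x, HHO.ev (HHO.facetDisc v T F) x ^ 2 ∂(HHO.facetMeasure F) with ht
  have hstab : HHO.stab v T = ∑ F ∈ HHO.facetsOf T, s F :=
    Finset.sum_congr rfl fun F hF => by rw [HHO.l2NormSq_stabS hn0 v hT hF]
  have halt : HHO.altStab v T = A + ∑ F ∈ HHO.facetsOf T, t F := rfl
  have hcard : ((HHO.facetsOf T).card : ℝ) = n + 1 := by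
    rw [HHO.facetsOf_eq_image hc, Finset.card_image_of_injOn (Finset.erase_injOn T), hc]
    push_cast; rfl
  have hst : ∀ F ∈ HHO.facetsOf T, s F ≤ 2 * t F + 2 * N * A ∧ t F ≤ 2 * s F + 2 * N * A :=
    fun F hF => by
      have hm := HHO.hasMoments_facet hn0 (𝒯.indep hf) hc hF
      obtain ⟨hd0, htr⟩ := hfacet T c r hsimp F hF
      have htr := htr e he
      set d := HHO.facetDisc v T F
      have hi := hm.sq (e - d)
      simp only [HHO.ev_sub] at hi
      have h1 : ∫ x, (HHO.ev e x - HHO.ev d x) ^ 2 ∂(HHO.facetMeasure F) ≤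
          2 * ∫ x, HHO.ev d x ^ 2 ∂(HHO.facetMeasure F) +
            2 * ∫ x, HHO.ev e x ^ 2 ∂(HHO.facetMeasure F) := by
        rw [← integral_const_mul, ← integral_const_mul,
          ← integral_add ((hm.sq _).const_mul 2) ((hm.sq _).const_mul 2)]
        exact integral_mono hi (((hm.sq _).const_mul 2).add ((hm.sq _).const_mul 2)) fun x => by
          change (HHO.ev e x - HHO.ev d x) ^ 2 ≤ 2 * HHO.ev d x ^ 2 + 2 * HHO.ev e x ^ 2
          nlinarith [sq_nonneg (HHO.ev e x + HHO.ev d x)]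
      have h2 : ∫ x, HHO.ev d x ^ 2 ∂(HHO.facetMeasure F) ≤
          2 * ∫ x, (HHO.ev e x - HHO.ev d x) ^ 2 ∂(HHO.facetMeasure F) +
            2 * ∫ x, HHO.ev e x ^ 2 ∂(HHO.facetMeasure F) := by
        rw [← integral_const_mul, ← integral_const_mul,
          ← integral_add (hi.const_mul 2) ((hm.sq _).const_mul 2)]
        exact integral_mono (hm.sq _) ((hi.const_mul 2).add ((hm.sq _).const_mul 2)) fun x => by
          change HHO.ev d x ^ 2 ≤ 2 * (HHO.ev e x - HHO.ev d x) ^ 2 + 2 * HHO.ev e x ^ 2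
          nlinarith [sq_nonneg (2 * HHO.ev e x - HHO.ev d x)]
      have h3 := mul_le_mul_of_nonneg_left h1 (inv_nonneg.2 hd0.le)
      have h4 := mul_le_mul_of_nonneg_left h2 (inv_nonneg.2 hd0.le)
      constructor
      · calc s F ≤ _ := h3
          _ = 2 * t F + 2 * ((HHO.diam F)⁻¹ * ∫ x, HHO.ev e x ^ 2 ∂(HHO.facetMeasure F)) := by
            simp only [ht]; ring
          _ ≤ _ := by linarith
      · calc t F ≤ _ := h4
          _ = 2 * s F + 2 * ((HHO.diam F)⁻¹ * ∫ x, HHO.ev e x ^ 2 ∂(HHO.facetMeasure F)) := by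
            simp only [hs]; ring
          _ ≤ _ := by linarith
  have h1 := Finset.sum_le_sum fun F hF => (hst F hF).1
  have h2 := Finset.sum_le_sum fun F hF => (hst F hF).2
  rw [Finset.sum_add_distrib, ← Finset.mul_sum, Finset.sum_const, nsmul_eq_mul, hcard] at h1 h2
  have hA0 : 0 ≤ A :=
    mul_nonneg (inv_nonneg.2 (sq_nonneg _)) (integral_nonneg fun x => sq_nonneg _)
  have ht0 : 0 ≤ ∑ F ∈ HHO.facetsOf T, t F := Finset.sum_nonneg fun F _ =>
    mul_nonneg (inv_nonneg.2 Metric.diam_nonneg) (integral_nonneg fun x => sq_nonneg _)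
  rw [hstab, halt]
  constructor
  · rw [inv_mul_le_iff₀ (by positivity)]
    have h3 := mul_le_mul_of_nonneg_left hbulk (show 0 ≤ 2 * ((n : ℝ) + 1) * N by positivity)
    linarith
  · have h3 : 0 ≤ 2 * ((n : ℝ) + 1) * N * ∑ F ∈ HHO.facetsOf T, t F :=
      mul_nonneg (by positivity) ht0
    linarith
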